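/- Let $k$ be a field, let $\mathcal A$ be a $k$-linear abelian category with enough injectives, and let $\mathcal D\subseteq D^b(\mathcal A)$ be a strictly full triangulated subcategory (for instance $\mathcal D=D^b(\mathcal A)$, or, for $\mathcal A$ the quasi-coherent sheaves on a smooth quasi-projective variety $X$, the complexes with coherent cohomology, $\mathcal D\simeq D^b(X)$). Write $\mathrm{Ext}^i(X,Y)=\mathrm{Hom}(X,Y[i])$. Let $N\ge 1$ be an integer and let $F\in\mathcal D$ be * $N$-spherical: $\mathrm{Ext}^i(F,F)\cong k$ for $i=0,N$ and $\mathrm{Ext}^i(F,F)=0$ for all other $i\in\mathbf Z$; and * with a duality: for an isomorphism $\mathrm{Ext}^N(F,F)\cong k$, the pairing given by composition $$\mathrm{Ext}^i(F,G)\otimes\mathrm{Ext}^{N-i}(G,F)\to\mathrm{Ext}^N(F,F)\cong k$$ is perfect (it identifies each factor with the full dual of the other) for all $G\in\mathcal D$ and all $i\in\mathbf Z$. These assumptions imply that $\mathbf R\mathrm{Hom}(F,G)$ and $\mathbf R\mathrm{Hom}(G,F)$ have finite-dimensional total cohomology for $G\in\mathcal D$. Represent objects of $\mathcal D$ by K-injective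 complexes (e.g. bounded below complexes of injectives). *The twist.* A functor $T:\mathcal D\to\mathcal D$ is called a twist functor $T_F$ if there are isomorphisms $$T(G)\cong\{F\otimes\mathbf R\mathrm{Hom}(F,G)\to G\},$$ where the right side is the cone of the evaluation map, realised as a morphism of complexes $\bigoplus_j F[n_j]\to G$ whose components are a graded basis of $\bigoplus_n\mathrm{Hom}(F[n],G)$, such that for every morphism of complexes $f:G\to G'$ and all choices of such bases, $T(f)$ corresponds to every map of cones induced by $f$, by the map $F\otimes\mathbf R\mathrm{Hom}(F,G)\to F\otimes\mathbf R\mathrm{Hom}(F,G')$ which is $\mathrm{id}_F$ tensored with a graded $k$-linear map of the second factors, and by a homotopy making the resulting square commute. *The dual twist.* A functor $T':\mathcal D\to\mathcal D$ is called a dual twist functor $T'_F$ if in the same way, compatibly with morphisms of complexes and the induced maps, $$T'(G)\cong\{G\to F\otimes\mathbf R\mathrm{Hom}(G,F)^*\}\quad(\cong\{G\to F\otimes\mathbf R\mathrm{Hom}(F,G)[N]\}\text{ by the duality}),$$ the total complex, with $G$ placed in degree $0$, of the map dual to the evaluation $G\otimes\mathbf R\mathrm{Hom}(G,F)\to F$;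 the map is realised as a morphism of complexes $G\to\bigoplus_jF[n_j]$ whose components are a graded basis of $\bigoplus_n\mathrm{Hom}(G,F[n])$. Then a twist functor $T_F$ and a dual twist functor $T'_F$ exist, and for all such functors $$T_F\circ T'_F\cong\mathrm{id}_{\mathcal D}\quad\text{and}\quad T'_F\circ T_F\cong\mathrm{id}_{\mathcal D}$$ (natural isomorphisms). In particular they are mutually inverse autoequivalences of $\mathcal D$. -/

import Mathlib

open CategoryTheory Limits

universe t w v u

namespace SphericalTwist

noncomputable section

section Spherical

variable (k : Type t) [Field k] {A : Type u} [Category.{v} A] [Abelian A] [Linear k A]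
  [HasDerivedCategory.{w} A]

/-- `Ext^i(X, Y)`, the `k`-vector space of morphisms `X ⟶ Y⟦i⟧` in the derived category. -/
abbrev DExt (X Y : DerivedCategory A) (i : ℤ) : Type w := ShiftedHom X Y i

/-- `F` is `N`-spherical: `Ext^i(F, F)` is one-dimensional for `i = 0, N`, and zero otherwise. -/
structure IsSpherical (N : ℤ) (F : DerivedCategory A) : Prop where
  ext_zero : Nonempty (DExt F F 0 ≃ₗ[k] k)
  ext_top : Nonempty (DExt F F N ≃ₗ[k] k)
  ext_other : ∀ i : ℤ, i ≠ 0 → i ≠ N → Subsingleton (DExt F F i)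

/-- The pairing `Ext^i(F, G) × Ext^(N - i)(G, F) → Ext^N(F, F) → k`, where the first map is the
composition of morphisms in the derived category and the second one is `tr`. -/
def extPairing (N : ℤ) (F : DerivedCategory A) (tr : DExt F F N ≃ₗ[k] k)
    (G : DerivedCategory A) (i : ℤ) : DExt F G i →ₗ[k] DExt G F (N - i) →ₗ[k] k :=
  LinearMap.mk₂ k (fun f g => tr (f.comp g (sub_add_cancel N i)))
    (fun f₁ f₂ g => by rw [ShiftedHom.add_comp, map_add])
    (fun c f g => by rw [ShiftedHom.smul_comp, map_smul])
    (fun f g₁ g₂ => by rw [ShiftedHom.comp_add, map_add])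
    (fun c f g => by rw [ShiftedHom.comp_smul, map_smul])

/-- `F` has a duality in dimension `N` with respect to the objects of `P`: for an identification
of `Ext^N(F, F)` with `k`, the pairing
`Ext^i(F, G) × Ext^(N - i)(G, F) → k` is perfect for all `G` in `P` and all `i`. (When
`Ext^N(F, F)` is one-dimensional, the choice of the identification does not matter.) -/
def HasDuality (P : ObjectProperty (DerivedCategory A)) (N : ℤ) (F : DerivedCategory A) : Prop :=
  ∃ tr : DExt F F N ≃ₗ[k] k, ∀ G : DerivedCategory A, P G → ∀ i : ℤ,
    (extPairing k N F tr G i).IsPerfPair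

end Spherical

section Twist

instance hasFiniteBiproducts_cochainComplex {A : Type u} [Category.{v} A] [Abelian A] :
    HasFiniteBiproducts (CochainComplex A ℤ) :=
  HasFiniteBiproducts.of_hasFiniteProducts

variable (k : Type t) [Field k] {A : Type u} [Category.{v} A] [Abelian A] [Linear k A]
  [HasDerivedCategory.{w} A]

/-- A finite family of morphisms of complexes `F⟦n⟧ ⟶ G` (finitely many for all `n` together)
whose classes form, for each `n`, a basis of
`Hom(F⟦n⟧, G) = Ext^(-n)(F, G)` in the derived category. It represents the graded vector space
`RHom(F, G)`, assumed to be of finite total dimension, by actual morphisms of complexes. -/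
structure EvalBasis (F G : CochainComplex A ℤ) where
  ι : ℤ → Type
  fintype_ι : ∀ n, Fintype (ι n)
  finite_sigma : Finite (Σ n, ι n)
  e : ∀ n, ι n → (F⟦n⟧ ⟶ G)
  linearIndependent : ∀ n,
    LinearIndependent k fun j : ι n => (DerivedCategory.Q.map (e n j))
  span_eq_top : ∀ n,
    Submodule.span k (Set.range fun j : ι n => (DerivedCategory.Q.map (e n j))) = ⊤

attribute [instance] EvalBasis.fintype_ι EvalBasis.finite_sigma

namespace EvalBasis

variable {k} {F G G' : CochainComplex A ℤ}

/-- The complex `F ⊗ RHom(F, G)`: one copy of `F⟦n⟧` for each basis element of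
`Hom(F⟦n⟧, G) = Ext^(-n)(F, G)`. -/
abbrev tensor (B : EvalBasis k F G) : CochainComplex A ℤ :=
  ⨁ fun p : (Σ n, B.ι n) => F⟦p.1⟧

/-- The evaluation `F ⊗ RHom(F, G) ⟶ G`, as a morphism of complexes. -/
def ev (B : EvalBasis k F G) : B.tensor ⟶ G :=
  biproduct.desc fun p : (Σ n, B.ι n) => B.e p.1 p.2

/-- The complex `{F ⊗ RHom(F, G) ⟶ G}` (with `G` in degree `0`). -/
abbrev cone (B : EvalBasis k F G) : CochainComplex A ℤ := CochainComplex.mappingCone B.ev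

/-- The morphism `F ⊗ RHom(F, G) ⟶ F ⊗ RHom(F, G')` which is the identity of `F` tensored with a
graded `k`-linear map `RHom(F, G) → RHom(F, G')`, given by its matrix. -/
def tensorMap (B : EvalBasis k F G) (B' : EvalBasis k F G')
    (a : ∀ n, B.ι n → B'.ι n → k) : B.tensor ⟶ B'.tensor :=
  biproduct.desc fun p : (Σ n, B.ι n) => ∑ j : B'.ι p.1, a p.1 p.2 j •
    biproduct.ι (fun p' : (Σ n, B'.ι n) => F⟦p'.1⟧) ⟨p.1, j⟩

end EvalBasis

/-- A finite family of morphisms of complexes `G ⟶ F⟦n⟧` (finitely many for all `n` together)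
whose classes form, for each `n`, a basis of `Hom(G, F⟦n⟧) = Ext^n(G, F)` in the derived
category. It represents the graded vector space `RHom(G, F)`, assumed to be of finite
total dimension, by actual morphisms of complexes. -/
structure CoevBasis (F G : CochainComplex A ℤ) where
  ι : ℤ → Type
  fintype_ι : ∀ n, Fintype (ι n)
  finite_sigma : Finite (Σ n, ι n)
  e : ∀ n, ι n → (G ⟶ F⟦n⟧)
  linearIndependent : ∀ n,
    LinearIndependent k fun j : ι n => (DerivedCategory.Q.map (e n j))
  span_eq_top : ∀ n,
    Submodule.span k (Set.range fun j : ι n => (DerivedCategory.Q.map (e n j))) = ⊤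

attribute [instance] CoevBasis.fintype_ι CoevBasis.finite_sigma

namespace CoevBasis

variable {k} {F G G' : CochainComplex A ℤ}

/-- The complex `F ⊗ RHom(G, F)^*`, where `RHom(G, F)^*` is the graded dual (for a spherical `F`
with a duality it is `RHom(F, G)[N]`): one copy of `F⟦n⟧` for each basis element of
`Hom(G, F⟦n⟧) = Ext^n(G, F)`. -/
abbrev tensor (B : CoevBasis k F G) : CochainComplex A ℤ :=
  ⨁ fun p : (Σ n, B.ι n) => F⟦p.1⟧

/-- The morphism of complexes `G ⟶ F ⊗ RHom(G, F)^*`, dual to the evaluation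
`G ⊗ RHom(G, F) ⟶ F`. -/
def coev (B : CoevBasis k F G) : G ⟶ B.tensor :=
  biproduct.lift fun p : (Σ n, B.ι n) => B.e p.1 p.2

/-- The complex `{G ⟶ F ⊗ RHom(G, F)^*}` (with `G` in degree `0`). -/
abbrev cocone (B : CoevBasis k F G) : CochainComplex A ℤ := CochainComplex.mappingCocone B.coev

/-- The morphism `F ⊗ RHom(G, F)^* ⟶ F ⊗ RHom(G', F)^*` which is the identity of `F` tensored
with the transpose of a graded `k`-linear map `RHom(G', F) → RHom(G, F)`, given by its
matrix. -/
def tensorMap (B : CoevBasis k F G) (B' : CoevBasis k F G')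
    (a : ∀ n, B'.ι n → B.ι n → k) : B.tensor ⟶ B'.tensor :=
  biproduct.lift fun p' : (Σ n, B'.ι n) => ∑ j : B.ι p'.1, a p'.1 p'.2 j •
    biproduct.π (fun p : (Σ n, B.ι n) => F⟦p.1⟧) ⟨p'.1, j⟩

end CoevBasis

variable (P : ObjectProperty (DerivedCategory A))

/-- The data identifying an endofunctor `T` of the full subcategory `P` of the derived category
with the twist along (the class of) a complex `F`, to be used for K-injective `F`. For K-injective
complexes `G` the object `T G` is the cone of the evaluation `F ⊗ RHom(F, G) ⟶ G`, and for
a morphism of complexes `f : G ⟶ G'` between such, `T f` is the morphism of cones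
induced by `f`, by the map `F ⊗ RHom(F, G) ⟶ F ⊗ RHom(F, G')` given by composition with `f`,
and by a homotopy making the square that they form commute. -/
structure TwistData (F : CochainComplex A ℤ) (T : P.FullSubcategory ⥤ P.FullSubcategory) where
  iso : ∀ (G : CochainComplex A ℤ) [G.IsKInjective] (hG : P (DerivedCategory.Q.obj G))
    (B : EvalBasis k F G),
    (T.obj ⟨DerivedCategory.Q.obj G, hG⟩).obj ≅ DerivedCategory.Q.obj B.cone
  naturality : ∀ (G G' : CochainComplex A ℤ) [G.IsKInjective] [G'.IsKInjective]
    (hG : P (DerivedCategory.Q.obj G)) (hG' : P (DerivedCategory.Q.obj G'))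
    (B : EvalBasis k F G) (B' : EvalBasis k F G') (f : G ⟶ G')
    (a : ∀ n, B.ι n → B'.ι n → k) (H : Homotopy (B.ev ≫ f) (B.tensorMap B' a ≫ B'.ev)),
    P.ι.map (T.map (P.homMk (DerivedCategory.Q.map f) :
        (⟨DerivedCategory.Q.obj G, hG⟩ : P.FullSubcategory) ⟶ ⟨DerivedCategory.Q.obj G', hG'⟩)) ≫
      (iso G' hG' B').hom =
    (iso G hG B).hom ≫ DerivedCategory.Q.map (CochainComplex.mappingCone.mapOfHomotopy H)

/-- `T` is the twist functor `T_F : G ↦ {F ⊗ RHom(F, G) ⟶ G}` on the full subcategory `P`,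
computed with a K-injective resolution of `F`. -/
def IsTwist (F : DerivedCategory A) (T : P.FullSubcategory ⥤ P.FullSubcategory) : Prop :=
  ∃ I : CochainComplex A ℤ, I.IsKInjective ∧ Nonempty (DerivedCategory.Q.obj I ≅ F) ∧
    Nonempty (TwistData k P I T)

/-- The data identifying an endofunctor `T'` of the full subcategory `P` of the derived category
with the dual twist along (the class of) a K-injective complex `F`. For K-injective complexes `G`
the object `T' G` is the total complex `{G ⟶ F ⊗ RHom(G, F)^*}` with `G` in degree `0`, and for a
morphism of complexes `f : G ⟶ G'` between such, `T' f` is the induced morphism,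
defined by means of a homotopy as for the twist. -/
structure DualTwistData (F : CochainComplex A ℤ)
    (T' : P.FullSubcategory ⥤ P.FullSubcategory) where
  iso : ∀ (G : CochainComplex A ℤ) [G.IsKInjective] (hG : P (DerivedCategory.Q.obj G))
    (B : CoevBasis k F G),
    (T'.obj ⟨DerivedCategory.Q.obj G, hG⟩).obj ≅ DerivedCategory.Q.obj B.cocone
  naturality : ∀ (G G' : CochainComplex A ℤ) [G.IsKInjective] [G'.IsKInjective]
    (hG : P (DerivedCategory.Q.obj G)) (hG' : P (DerivedCategory.Q.obj G'))
    (B : CoevBasis k F G) (B' : CoevBasis k F G') (f : G ⟶ G')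
    (a : ∀ n, B'.ι n → B.ι n → k) (H : Homotopy (B.coev ≫ B.tensorMap B' a) (f ≫ B'.coev)),
    P.ι.map (T'.map (P.homMk (DerivedCategory.Q.map f) :
        (⟨DerivedCategory.Q.obj G, hG⟩ : P.FullSubcategory) ⟶ ⟨DerivedCategory.Q.obj G', hG'⟩)) ≫
      (iso G' hG' B').hom =
    (iso G hG B).hom ≫ DerivedCategory.Q.map
      ((CochainComplex.mappingCone.mapOfHomotopy H)⟦(-1 : ℤ)⟧')

/-- `T'` is the dual twist functor
`T'_F : G ↦ {G ⟶ F ⊗ RHom(G, F)^*} = {G ⟶ F ⊗ RHom(F, G)[N]}` on the full subcategory `P`,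
computed with a K-injective resolution of `F`. -/
def IsDualTwist (F : DerivedCategory A) (T' : P.FullSubcategory ⥤ P.FullSubcategory) : Prop :=
  ∃ I : CochainComplex A ℤ, I.IsKInjective ∧ Nonempty (DerivedCategory.Q.obj I ≅ F) ∧
    Nonempty (DualTwistData k P I T')

end Twist

end

end SphericalTwist

/-!
A spherical object `F` with a duality defines two operations on `P`. The twist takes `G` to the
cone `T G` of `ev : F ⊗ RHom(F, G) ⟶ G`, and the dual twist takes `G` to the shifted cone `T' G`
of `coev : G ⟶ F ⊗ RHom(G, F)^*`. Both are defined on complexes with chosen bases of the graded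
spaces of morphisms, and two points carry the proof.

*Functoriality.* A morphism of cones induced by a square that commutes up to homotopy depends in
general on the homotopy. Here it does not, in the derived category: two choices differ by a
morphism that factors through some `(F ⊗ RHom(F, G))⟦1⟧ ⟶ G'`, every such morphism factors through
the evaluation of `G'` (`EvalBasis.exists_eq_comp_ev`), and the composition of `ev` with
`G' ⟶ T G'` vanishes (`IsConeMap.Q_map_eq_of_left_eq`; dually `CoevBasis.exists_eq_coev_comp` and
`IsConeMap.Q_map_eq_of_right_eq`). Since `ev` determines the matrix of the map of the first terms,
the induced morphisms are unique, hence compatible with compositions, and give functors by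
`exists_functor_of_relation`. The bases exist, and are finite in total, because the objects of `P`
are bounded and the pairing is perfect.

*Inverses.* Apply `Hom(-, F⟦n⟧)` to the triangle `F ⊗ RHom(F, G) ⟶ G ⟶ T G ⟶`. By the duality
`Hom(G, F⟦n⟧)` is dual to `Hom(F⟦n - N⟧, G)`; as `Hom(F⟦m⟧, F⟦n⟧)` is one-dimensional for
`n = m, m + N` and zero otherwise, the contributions of degree `N` cancel exactly against
`Hom(G, F⟦n⟧)`, and the components of `T G ⟶ (F ⊗ RHom(F, G))⟦1⟧` are a basis of `RHom(T G, F)`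
(`IsSphericalFamily.linearIndependent_cone`, `IsSphericalFamily.span_cone`,
`EvalBasis.coneBasis`). With this basis the coevaluation of `T G` is the third morphism of the
triangle that defines `T G`, so that its shifted cone is `G` by rotation (`rotationIso`). The other
composition is dual (`IsSphericalFamily.linearIndependent_cocone`,
`IsSphericalFamily.span_cocone`, `CoevBasis.coconeBasis`, `invRotationIso`). To obtain natural
isomorphisms, the rotations are performed by morphisms of complexes that are strictly compatible
with the induced morphisms of cones.
-/

/-! ### Spherical families in a triangulated category -/

namespace SphericalTwist

noncomputable section

open Pretriangulated

section Exactness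

variable {C : Type u} [Category.{v} C] [Preadditive C] [HasZeroObject C] [HasShift C ℤ]
  [∀ n : ℤ, (shiftFunctor C n).Additive] [Pretriangulated C]
  {X Y Z : C} {f : X ⟶ Y} {g : Y ⟶ Z} {h : Z ⟶ X⟦(1 : ℤ)⟧}
  (hT : Triangle.mk f g h ∈ distTriang C)

include hT

lemma exists_eq_mor₃_comp {W : C} (x : Z ⟶ W) (hx : g ≫ x = 0) :
    ∃ y : X⟦(1 : ℤ)⟧ ⟶ W, x = h ≫ y :=
  Triangle.yoneda_exact₃ _ hT x hx

lemma exists_eq_shift_mor₁_comp {W : C} (x : X⟦(1 : ℤ)⟧ ⟶ W) (hx : h ≫ x = 0) :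
    ∃ y : Y⟦(1 : ℤ)⟧ ⟶ W, x = f⟦(1 : ℤ)⟧' ≫ y := by
  obtain ⟨y, hy⟩ : ∃ y : Y⟦(1 : ℤ)⟧ ⟶ W, x = (-f⟦(1 : ℤ)⟧') ≫ y :=
    Triangle.yoneda_exact₃ _ (rot_of_distTriang _ hT) x hx
  exact ⟨-y, by rw [hy, Preadditive.neg_comp, Preadditive.comp_neg]⟩

lemma exists_eq_comp_mor₁ {W : C} (x : W ⟶ Y) (hx : x ≫ g = 0) : ∃ y : W ⟶ X, x = y ≫ f :=
  Triangle.coyoneda_exact₂ _ hT x hx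

lemma exists_eq_comp_mor₂ {W : C} (x : W ⟶ Z) (hx : x ≫ h = 0) : ∃ y : W ⟶ Y, x = y ≫ g :=
  Triangle.coyoneda_exact₃ _ hT x hx

end Exactness

section Family

variable {C : Type u} [Category.{v} C] [Preadditive C]

/-- The properties of the shifts `Φ n = F⟦n⟧` of a spherical object `F` with a duality (with
respect to the objects satisfying `P`) that the proof uses. The perfectness of the pairing
`Hom(Φ n, X) × Hom(X, Φ (n + N)) → Hom(Φ n, Φ (n + N))` is expressed without choosing a
coordinate on the one-dimensional target: it is nondegenerate on both sides, and every linear map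
from one factor to the target is given by composition with an element of the other factor. -/
structure IsSphericalFamily (k : Type t) [Field k] [Linear k C] [HasShift C ℤ]
    (P : ObjectProperty C) (N : ℤ) (Φ : ℤ → C) : Prop where
  shift : ∀ n, Nonempty ((Φ n)⟦(1 : ℤ)⟧ ≅ Φ (n + 1))
  id_ne_zero : ∀ n, 𝟙 (Φ n) ≠ 0
  exists_smul_id : ∀ n (x : Φ n ⟶ Φ n), ∃ c : k, x = c • 𝟙 (Φ n)
  hom_eq_zero : ∀ n m, m ≠ n → m ≠ n + N → ∀ x : Φ n ⟶ Φ m, x = 0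
  eq_zero_left : ∀ n m, m = n + N → ∀ X, P X → ∀ e : Φ n ⟶ X,
    (∀ w : X ⟶ Φ m, e ≫ w = 0) → e = 0
  eq_zero_right : ∀ n m, m = n + N → ∀ X, P X → ∀ w : X ⟶ Φ m,
    (∀ e : Φ n ⟶ X, e ≫ w = 0) → w = 0
  exists_right : ∀ n m, m = n + N → ∀ X, P X → ∀ l : (Φ n ⟶ X) →ₗ[k] (Φ n ⟶ Φ m),
    ∃ w : X ⟶ Φ m, ∀ e, l e = e ≫ w
  exists_left : ∀ n m, m = n + N → ∀ X, P X → ∀ l : (X ⟶ Φ m) →ₗ[k] (Φ n ⟶ Φ m),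
    ∃ e : Φ n ⟶ X, ∀ w, l w = e ≫ w

variable {k : Type t} [Field k] [Linear k C] {P : ObjectProperty C} {N : ℤ} {Φ : ℤ → C}
  {J : ℤ → Type} [∀ n, Fintype (J n)]

lemma ι_comp_sum_smul_π (b : Bicone fun p : (Σ n, J n) => Φ p.1) {n : ℤ} (g : J n → k) (j : J n) :
    b.ι ⟨n, j⟩ ≫ (∑ i, g i • b.π ⟨n, i⟩ : b.pt ⟶ Φ n) = g j • 𝟙 (Φ n) := by
  rw [Preadditive.comp_sum, Finset.sum_eq_single j]
  · rw [Linear.comp_smul, bicone_ι_π_self]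
  · intro i _ hij
    rw [Linear.comp_smul, bicone_ι_π_ne _ (by simpa using Ne.symm hij), smul_zero]
  · simp

lemma ι_comp_sum_smul_π_of_ne (b : Bicone fun p : (Σ n, J n) => Φ p.1) {n m : ℤ} (h : m ≠ n)
    (g : J n → k) (j : J m) : b.ι ⟨m, j⟩ ≫ (∑ i, g i • b.π ⟨n, i⟩ : b.pt ⟶ Φ n) = 0 := by
  rw [Preadditive.comp_sum]
  refine Finset.sum_eq_zero fun i _ => ?_
  rw [Linear.comp_smul, bicone_ι_π_ne _ (fun h' => h (congrArg Sigma.fst h')), smul_zero]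

lemma sum_smul_ι_comp_π (b : Bicone fun p : (Σ n, J n) => Φ p.1) {n : ℤ} (g : J n → k) (j : J n) :
    (∑ i, g i • b.ι ⟨n, i⟩ : Φ n ⟶ b.pt) ≫ b.π ⟨n, j⟩ = g j • 𝟙 (Φ n) := by
  rw [Preadditive.sum_comp, Finset.sum_eq_single j]
  · rw [Linear.smul_comp, bicone_ι_π_self]
  · intro i _ hij
    rw [Linear.smul_comp, bicone_ι_π_ne _ (by simpa using hij), smul_zero]
  · simp

lemma sum_smul_ι_comp_π_of_ne (b : Bicone fun p : (Σ n, J n) => Φ p.1) {n m : ℤ} (h : m ≠ n)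
    (g : J n → k) (j : J m) : (∑ i, g i • b.ι ⟨n, i⟩ : Φ n ⟶ b.pt) ≫ b.π ⟨m, j⟩ = 0 := by
  rw [Preadditive.sum_comp]
  refine Finset.sum_eq_zero fun i _ => ?_
  rw [Linear.smul_comp, bicone_ι_π_ne _ (fun h' => h (congrArg Sigma.fst h').symm), smul_zero]

lemma eq_zero_of_smul_id_eq_zero {X : C} (hX : 𝟙 X ≠ 0) {c : k} (h : c • 𝟙 X = 0) : c = 0 :=
  (smul_eq_zero.1 h).resolve_right hX

namespace IsSphericalFamily

variable [HasShift C ℤ] (hΦ : IsSphericalFamily k P N Φ)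

include hΦ in
/-- One half of the nondegeneracy of the pairing, tested on a spanning family of `Hom(Φ n, G)`. -/
lemma eq_zero_of_span_right {G X : C} (hG : P G) {n m : ℤ} (hm : m = n + N)
    (e : J n → (Φ n ⟶ G)) (hspan : Submodule.span k (Set.range e) = ⊤) (s : X ≅ Φ m) (w : G ⟶ X)
    (h : ∀ j, e j ≫ w = 0) : w = 0 := by
  rw [← cancel_mono s.hom, zero_comp]
  refine hΦ.eq_zero_right n m hm G hG _ fun x => ?_
  have hx : x ∈ Submodule.span k (Set.range e) := hspan ▸ Submodule.mem_top
  obtain ⟨c, rfl⟩ := (Submodule.mem_span_range_iff_exists_fun k).1 hx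
  simp [Preadditive.sum_comp, reassoc_of% h]

include hΦ in
/-- One half of the nondegeneracy of the pairing, tested on a spanning family of `Hom(G, Φ m)`. -/
lemma eq_zero_of_span_left {G X : C} (hG : P G) {n m : ℤ} (hm : m = n + N)
    (e : J m → (G ⟶ Φ m)) (hspan : Submodule.span k (Set.range e) = ⊤) (s : Φ n ≅ X) (v : X ⟶ G)
    (h : ∀ j, v ≫ e j = 0) : v = 0 := by
  rw [← cancel_epi s.hom, comp_zero]
  refine hΦ.eq_zero_left n m hm G hG _ fun x => ?_
  have hx : x ∈ Submodule.span k (Set.range e) := hspan ▸ Submodule.mem_top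
  obtain ⟨c, rfl⟩ := (Submodule.mem_span_range_iff_exists_fun k).1 hx
  simp [Preadditive.comp_sum, h]

variable [HasZeroObject C] [∀ n : ℤ, (shiftFunctor C n).Additive] [Pretriangulated C]
  (hN : 1 ≤ N) (b : Bicone fun p : (Σ n, J n) => Φ p.1)

section Cone

variable {G X : C} (hG : P G) {ev : b.pt ⟶ G} {i : G ⟶ X} {δ : X ⟶ b.pt⟦(1 : ℤ)⟧}
  (hT : Triangle.mk ev i δ ∈ distTriang C)
  (hli : ∀ n, LinearIndependent k fun j : J n => (b.ι ⟨n, j⟩ ≫ ev : Φ n ⟶ G))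
  (hspan : ∀ n, Submodule.span k (Set.range fun j : J n => (b.ι ⟨n, j⟩ ≫ ev : Φ n ⟶ G)) = ⊤)
  [∀ n : ℤ, (shiftFunctor C n).Linear k]

include hΦ hN hG hT hspan in
/-- The cone `X` of the evaluation `S ⟶ G`: the components of `X ⟶ S⟦1⟧` are linearly
independent, because a linear combination that vanishes comes from a morphism `G ⟶ Φ n` which is
orthogonal to `Hom(Φ (n - N), G)`. -/
lemma linearIndependent_cone (n : ℤ) :
    LinearIndependent k fun j : J n =>
      (δ ≫ (b.π ⟨n, j⟩)⟦(1 : ℤ)⟧' : X ⟶ (Φ n)⟦(1 : ℤ)⟧) := by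
  rw [Fintype.linearIndependent_iff]
  intro g hg
  set x : b.pt ⟶ Φ n := ∑ j, g j • b.π ⟨n, j⟩ with hx
  have h1 : δ ≫ x⟦(1 : ℤ)⟧' = 0 := by
    rw [← hg, hx, Functor.map_sum, Preadditive.comp_sum]
    simp [Functor.map_smul]
  obtain ⟨w', hw'⟩ := exists_eq_shift_mor₁_comp hT (x⟦(1 : ℤ)⟧') h1
  obtain ⟨w, hw⟩ := (shiftFunctor C (1 : ℤ)).map_surjective w'
  have h2 : x = ev ≫ w := by
    apply (shiftFunctor C (1 : ℤ)).map_injective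
    rw [Functor.map_comp, hw, hw']
  have h3 : w = 0 := by
    refine hΦ.eq_zero_of_span_right hG (by omega) _ (hspan (n - N)) (Iso.refl _) w fun j => ?_
    rw [Category.assoc, ← h2, hx, ι_comp_sum_smul_π_of_ne _ (by omega)]
  intro j
  apply eq_zero_of_smul_id_eq_zero (hΦ.id_ne_zero n)
  rw [← ι_comp_sum_smul_π b g j, ← hx, h2, h3, comp_zero, comp_zero]

include hΦ hG hT hli hspan in
/-- The cone `X` of the evaluation `S ⟶ G`: the components of `X ⟶ S⟦1⟧` span. A morphism
`X ⟶ (Φ n)⟦1⟧` comes from `S⟦1⟧` as its restriction to `G` is orthogonal to everything, and by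
the perfectness of the pairing it may be changed by a morphism from `G⟦1⟧` so as to vanish on all
the summands but those isomorphic to `(Φ n)⟦1⟧`. -/
lemma span_cone [Fintype (Σ n, J n)] (hb : ∑ p, b.π p ≫ b.ι p = 𝟙 b.pt) (n : ℤ) :
    Submodule.span k (Set.range fun j : J n =>
      (δ ≫ (b.π ⟨n, j⟩)⟦(1 : ℤ)⟧' : X ⟶ (Φ n)⟦(1 : ℤ)⟧)) = ⊤ := by
  rw [eq_top_iff]
  rintro y -
  have h12 : ev ≫ i = 0 := comp_distTriang_mor_zero₁₂ _ hT
  have h31 : δ ≫ ev⟦(1 : ℤ)⟧' = 0 := comp_distTriang_mor_zero₃₁ _ hT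
  obtain ⟨s⟩ := hΦ.shift n
  have hiy : i ≫ y = 0 := by
    refine hΦ.eq_zero_of_span_right hG (n := n + 1 - N) (by omega) _ (hspan _) s _ fun j => ?_
    rw [Category.assoc, reassoc_of% h12, zero_comp, comp_zero]
  obtain ⟨z', hz'⟩ := exists_eq_mor₃_comp hT y hiy
  obtain ⟨z, rfl⟩ := (shiftFunctor C (1 : ℤ)).map_surjective z'
  let e := Module.Basis.mk (hli (n - N)) (hspan (n - N)).ge
  -- the functional on `Hom(Φ (n - N), G)` given by the components of `z` in degree `n - N` is
  -- represented by a morphism `w : G ⟶ Φ n`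
  obtain ⟨w, hw⟩ := hΦ.exists_right (n - N) n (by omega) G hG
    (e.constr k fun j => b.ι ⟨n - N, j⟩ ≫ z)
  have hw' (j : J (n - N)) : b.ι ⟨n - N, j⟩ ≫ (z - ev ≫ w) = 0 := by
    have h := hw (e j)
    rw [Module.Basis.constr_basis, Module.Basis.mk_apply] at h
    rw [Preadditive.comp_sub, h, Category.assoc, sub_self]
  have hmem : z - ev ≫ w ∈ Submodule.span k (Set.range fun j : J n => (b.π ⟨n, j⟩ : b.pt ⟶ Φ n)) := by
    rw [← Category.id_comp (z - ev ≫ w), ← hb, Preadditive.sum_comp]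
    refine Submodule.sum_mem _ ?_
    rintro ⟨m, j⟩ -
    rw [Category.assoc]
    by_cases h1 : m = n
    · subst h1
      obtain ⟨c, hc⟩ := hΦ.exists_smul_id m (b.ι ⟨m, j⟩ ≫ (z - ev ≫ w))
      rw [hc, Linear.comp_smul, Category.comp_id]
      exact Submodule.smul_mem _ _ (Submodule.subset_span ⟨j, rfl⟩)
    · have h0 : b.ι ⟨m, j⟩ ≫ (z - ev ≫ w) = 0 := by
        by_cases h2 : n = m + N
        · obtain rfl : m = n - N := by omega
          exact hw' j
        · exact hΦ.hom_eq_zero _ _ (Ne.symm h1) h2 _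
      rw [h0, comp_zero]
      exact Submodule.zero_mem _
  have hy : y = δ ≫ (z - ev ≫ w)⟦(1 : ℤ)⟧' := by
    rw [Functor.map_sub, Functor.map_comp, Preadditive.comp_sub, reassoc_of% h31, zero_comp,
      sub_zero]
    exact hz'
  have h := Submodule.mem_map_of_mem (f := (Linear.leftComp k ((Φ n)⟦(1 : ℤ)⟧) δ).comp
    ((shiftFunctor C (1 : ℤ)).mapLinearMap k)) hmem
  rw [Submodule.map_span, ← Set.range_comp] at h
  rw [hy]
  exact h

end Cone

section Cocone

variable {G Y : C} (hG : P G) {c : G ⟶ b.pt} {i : b.pt ⟶ Y} {δ : Y ⟶ G⟦(1 : ℤ)⟧}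
  (hT : Triangle.mk c i δ ∈ distTriang C)
  (hli : ∀ n, LinearIndependent k fun j : J n => (c ≫ b.π ⟨n, j⟩ : G ⟶ Φ n))
  (hspan : ∀ n, Submodule.span k (Set.range fun j : J n => (c ≫ b.π ⟨n, j⟩ : G ⟶ Φ n)) = ⊤)

include hΦ hN hG hT hspan in
/-- The cone `Y` of the coevaluation `G ⟶ S`: the components of `S ⟶ Y` are linearly
independent, because a linear combination that vanishes comes from a morphism `Φ n ⟶ G` which is
orthogonal to `Hom(G, Φ (n + N))`. -/
lemma linearIndependent_cocone (n : ℤ) :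
    LinearIndependent k fun j : J n => (b.ι ⟨n, j⟩ ≫ i : Φ n ⟶ Y) := by
  rw [Fintype.linearIndependent_iff]
  intro g hg
  set x : Φ n ⟶ b.pt := ∑ j, g j • b.ι ⟨n, j⟩ with hx
  have h1 : x ≫ i = 0 := by
    rw [← hg, hx, Preadditive.sum_comp]
    simp
  obtain ⟨v, hv⟩ := exists_eq_comp_mor₁ hT x h1
  have h3 : v = 0 := by
    refine hΦ.eq_zero_of_span_left hG rfl _ (hspan (n + N)) (Iso.refl _) v fun j => ?_
    rw [← Category.assoc, ← hv, hx, sum_smul_ι_comp_π_of_ne _ (by omega)]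
  intro j
  apply eq_zero_of_smul_id_eq_zero (hΦ.id_ne_zero n)
  rw [← sum_smul_ι_comp_π b g j, ← hx, hv, h3, zero_comp, zero_comp]

include hΦ hG hT hli hspan in
/-- The cone `Y` of the coevaluation `G ⟶ S`: the components of `S ⟶ Y` span. A morphism
`Φ n ⟶ Y` comes from `S` as its composition with `Y ⟶ G⟦1⟧` is orthogonal to everything, and by the
perfectness of the pairing it may be changed by a morphism to `G` so as to vanish in all the
summands but those isomorphic to `Φ n`. -/
lemma span_cocone [Fintype (Σ n, J n)] (hb : ∑ p, b.π p ≫ b.ι p = 𝟙 b.pt) (n : ℤ) :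
    Submodule.span k (Set.range fun j : J n => (b.ι ⟨n, j⟩ ≫ i : Φ n ⟶ Y)) = ⊤ := by
  rw [eq_top_iff]
  rintro y -
  have h12 : c ≫ i = 0 := comp_distTriang_mor_zero₁₂ _ hT
  have h31 : δ ≫ c⟦(1 : ℤ)⟧' = 0 := comp_distTriang_mor_zero₃₁ _ hT
  obtain ⟨s⟩ := hΦ.shift (n - 1)
  have s' : (Φ (n - 1))⟦(1 : ℤ)⟧ ≅ Φ n := s ≪≫ eqToIso (by congr 1; omega)
  have hyδ : y ≫ δ = 0 := by
    obtain ⟨v, hv⟩ := (shiftFunctor C (1 : ℤ)).map_surjective (s'.hom ≫ y ≫ δ)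
    have hv0 : v = 0 := by
      refine hΦ.eq_zero_of_span_left hG (m := n - 1 + N) rfl _ (hspan _) (Iso.refl _) v
        fun j => ?_
      apply (shiftFunctor C (1 : ℤ)).map_injective
      rw [Functor.map_comp, Functor.map_comp, hv, Category.assoc, Category.assoc,
        reassoc_of% h31, zero_comp, comp_zero, comp_zero, Functor.map_zero]
    rw [hv0, Functor.map_zero] at hv
    rw [← cancel_epi s'.hom, ← hv, comp_zero]
  obtain ⟨z, hz⟩ := exists_eq_comp_mor₂ hT y hyδ
  let e := Module.Basis.mk (hli (n + N)) (hspan (n + N)).ge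
  -- the functional on `Hom(G, Φ (n + N))` given by the components of `z` in degree `n + N` is
  -- represented by a morphism `w : Φ n ⟶ G`
  obtain ⟨w, hw⟩ := hΦ.exists_left n (n + N) rfl G hG
    (e.constr k fun j => z ≫ b.π ⟨n + N, j⟩)
  have hw' (j : J (n + N)) : (z - w ≫ c) ≫ b.π ⟨n + N, j⟩ = 0 := by
    have h := hw (e j)
    rw [Module.Basis.constr_basis, Module.Basis.mk_apply] at h
    rw [Preadditive.sub_comp, h, Category.assoc, sub_self]
  have hmem : z - w ≫ c ∈ Submodule.span k (Set.range fun j : J n => (b.ι ⟨n, j⟩ : Φ n ⟶ b.pt)) := by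
    rw [← Category.comp_id (z - w ≫ c), ← hb, Preadditive.comp_sum]
    refine Submodule.sum_mem _ ?_
    rintro ⟨m, j⟩ -
    rw [← Category.assoc]
    by_cases h1 : m = n
    · subst h1
      obtain ⟨a, ha⟩ := hΦ.exists_smul_id m ((z - w ≫ c) ≫ b.π ⟨m, j⟩)
      rw [ha, Linear.smul_comp, Category.id_comp]
      exact Submodule.smul_mem _ _ (Submodule.subset_span ⟨j, rfl⟩)
    · have h0 : (z - w ≫ c) ≫ b.π ⟨m, j⟩ = 0 := by
        by_cases h2 : m = n + N
        · subst h2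
          exact hw' j
        · exact hΦ.hom_eq_zero _ _ h1 h2 _
      rw [h0, zero_comp]
      exact Submodule.zero_mem _
  have hy : y = (z - w ≫ c) ≫ i := by
    rw [Preadditive.sub_comp, Category.assoc, h12, comp_zero, sub_zero, hz]
  have h := Submodule.mem_map_of_mem (f := Linear.rightComp k (Φ n) i) hmem
  rw [Submodule.map_span, ← Set.range_comp] at h
  rw [hy]
  exact h

end Cocone

end IsSphericalFamily

end Family

end

end SphericalTwist

/-! ### The shifts of a spherical object with a duality -/

namespace SphericalTwist

noncomputable section

section Duality

variable {k : Type t} [Field k] {A : Type u} [Category.{v} A] [Abelian A] [Linear k A]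
  [HasDerivedCategory.{w} A]

variable (k) in
/-- The shift functor as a linear equivalence on morphisms. -/
def shiftHomEquiv (X Y : DerivedCategory A) (n : ℤ) : (X ⟶ Y) ≃ₗ[k] (X⟦n⟧ ⟶ Y⟦n⟧) :=
  LinearEquiv.ofBijective ((shiftFunctor (DerivedCategory A) n).mapLinearMap k)
    ⟨(shiftFunctor (DerivedCategory A) n).map_injective,
      (shiftFunctor (DerivedCategory A) n).map_surjective⟩

@[simp]
lemma shiftHomEquiv_apply {X Y : DerivedCategory A} (n : ℤ) (f : X ⟶ Y) :
    shiftHomEquiv k X Y n f = f⟦n⟧' :=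
  rfl

variable {F : DerivedCategory A} {Ψ : ℤ → DerivedCategory A} (θ : ∀ n, Ψ n ≅ F⟦n⟧)

/-- The isomorphism `(Ψ n)⟦-n⟧ ≅ F` when `Ψ n ≅ F⟦n⟧`. -/
def unshiftIso (n : ℤ) : (Ψ n)⟦-n⟧ ≅ F :=
  (shiftFunctor _ (-n)).mapIso (θ n) ≪≫
    (shiftFunctorCompIsoId (DerivedCategory A) n (-n) (by omega)).app F

variable (k) in
/-- `Hom(F⟦n⟧, X) = Ext^(-n)(F, X)`. -/
def homLeftEquiv (n : ℤ) (X : DerivedCategory A) : (Ψ n ⟶ X) ≃ₗ[k] DExt F X (-n) :=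
  shiftHomEquiv k _ _ (-n) ≪≫ₗ Linear.homCongr k (unshiftIso θ n) (Iso.refl _)

variable (k) in
/-- `Hom(X, F⟦m⟧) = Ext^m(X, F)`. -/
def homRightEquiv (m : ℤ) (X : DerivedCategory A) : (X ⟶ Ψ m) ≃ₗ[k] DExt X F m :=
  Linear.homCongr k (Iso.refl _) (θ m)

variable (k) in
/-- `Hom(F⟦n⟧, F⟦m⟧) = Ext^(m - n)(F, F)`. -/
def homHomEquiv (n m d : ℤ) (h : m + -n = d) : (Ψ n ⟶ Ψ m) ≃ₗ[k] DExt F F d :=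
  shiftHomEquiv k _ _ (-n) ≪≫ₗ Linear.homCongr k (unshiftIso θ n)
    ((shiftFunctor _ (-n)).mapIso (θ m) ≪≫ (shiftFunctorAdd' _ m (-n) d h).symm.app F)

lemma homLeftEquiv_comp_homRightEquiv (n m d : ℤ) (h : m + -n = d) {X : DerivedCategory A}
    (e : Ψ n ⟶ X) (w : X ⟶ Ψ m) :
    ShiftedHom.comp (homLeftEquiv k θ n X e) (homRightEquiv k θ m X w) h =
      homHomEquiv k θ n m d h (e ≫ w) := by
  simp [homLeftEquiv, homRightEquiv, homHomEquiv, ShiftedHom.comp,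
    Linear.homCongr_apply]

variable {P : ObjectProperty (DerivedCategory A)} {N : ℤ}

include θ in
/-- The duality, in terms of the morphisms `F⟦n⟧ ⟶ X` and `X ⟶ F⟦n + N⟧`. -/
lemma HasDuality.exists_perfect (hdual : HasDuality k P N F) (n m : ℤ) (hm : m = n + N)
    (X : DerivedCategory A) (hX : P X) :
    ∃ (tr : (Ψ n ⟶ Ψ m) ≃ₗ[k] k) (p : (Ψ n ⟶ X) →ₗ[k] (X ⟶ Ψ m) →ₗ[k] k),
      p.IsPerfPair ∧ ∀ e w, p e w = tr (e ≫ w) := by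
  obtain ⟨tr, htr⟩ := hdual
  obtain rfl : m = N - -n := by omega
  have := htr X hX (-n)
  refine ⟨homHomEquiv k θ n (N - -n) N (by omega) ≪≫ₗ tr,
    (extPairing k N F tr X (-n)).compl₁₂ (homLeftEquiv k θ n X).toLinearMap
      (homRightEquiv k θ (N - -n) X).toLinearMap, inferInstance, fun e w => ?_⟩
  rw [LinearEquiv.trans_apply, ← homLeftEquiv_comp_homRightEquiv]
  rfl

include θ in
lemma isSphericalFamily (hsph : IsSpherical k N F) (hdual : HasDuality k P N F) :
    IsSphericalFamily k P N Ψ where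
  shift n := ⟨(shiftFunctor _ (1 : ℤ)).mapIso (θ n) ≪≫
    ((shiftFunctorAdd' _ n 1 (n + 1) rfl).symm.app F) ≪≫ (θ (n + 1)).symm⟩
  id_ne_zero n h := by
    obtain ⟨e⟩ := hsph.ext_zero
    have h1 : ((homHomEquiv k θ n n 0 (by omega)).trans e).symm 1 = 0 := by
      rw [← Category.comp_id (LinearEquiv.symm _ _), h, comp_zero]
    exact one_ne_zero ((LinearEquiv.map_eq_zero_iff _).1 h1)
  exists_smul_id n x := by
    obtain ⟨e⟩ := hsph.ext_zero
    let e' := (homHomEquiv k θ n n 0 (by omega)).trans e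
    by_cases h : e' (𝟙 _) = 0
    · refine ⟨0, ?_⟩
      rw [← Category.comp_id x, (LinearEquiv.map_eq_zero_iff _).1 h, comp_zero, smul_zero]
    · refine ⟨e' x * (e' (𝟙 _))⁻¹, e'.injective ?_⟩
      rw [map_smul, smul_eq_mul, mul_assoc, inv_mul_cancel₀ h, mul_one]
  hom_eq_zero n m h1 h2 x := by
    have := hsph.ext_other (m + -n) (by omega) (by omega)
    exact (homHomEquiv k θ n m (m + -n) rfl).injective (Subsingleton.elim _ _)
  eq_zero_left n m hm X hX e he := by
    obtain ⟨tr, p, hp, h⟩ := hdual.exists_perfect θ n m hm X hX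
    refine hp.bijective_left.1 (LinearMap.ext fun w => ?_)
    rw [h, he, map_zero, map_zero, LinearMap.zero_apply]
  eq_zero_right n m hm X hX w hw := by
    obtain ⟨tr, p, hp, h⟩ := hdual.exists_perfect θ n m hm X hX
    refine hp.bijective_right.1 (LinearMap.ext fun e => ?_)
    rw [LinearMap.flip_apply, h, hw, map_zero, map_zero, LinearMap.zero_apply]
  exists_right n m hm X hX l := by
    obtain ⟨tr, p, hp, h⟩ := hdual.exists_perfect θ n m hm X hX
    obtain ⟨w, hw⟩ := hp.bijective_right.2 (tr.toLinearMap ∘ₗ l)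
    refine ⟨w, fun e => tr.injective ?_⟩
    rw [← h, ← LinearMap.flip_apply, hw]
    rfl
  exists_left n m hm X hX l := by
    obtain ⟨tr, p, hp, h⟩ := hdual.exists_perfect θ n m hm X hX
    obtain ⟨e, he⟩ := hp.bijective_left.2 (tr.toLinearMap ∘ₗ l)
    refine ⟨e, fun w => tr.injective ?_⟩
    rw [← h, he]
    rfl

include θ in
lemma finite_hom_left (hdual : HasDuality k P N F) (n : ℤ) {X : DerivedCategory A} (hX : P X) :
    Module.Finite k (Ψ n ⟶ X) := by
  obtain ⟨tr, p, hp, h⟩ := hdual.exists_perfect θ n _ rfl X hX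
  have : Module.IsReflexive k (Ψ n ⟶ X) := .of_isPerfPair p
  infer_instance

include θ in
lemma finite_hom_right (hdual : HasDuality k P N F) (m : ℤ) {X : DerivedCategory A} (hX : P X) :
    Module.Finite k (X ⟶ Ψ m) := by
  obtain ⟨tr, p, hp, h⟩ := hdual.exists_perfect θ (m - N) m (by omega) X hX
  have : Module.IsReflexive k (X ⟶ Ψ m) := .of_isPerfPair p.flip
  infer_instance

include θ in
/-- For bounded `F` and `X` there are no nonzero morphisms `F⟦n⟧ ⟶ X` for large `n`, nor nonzero
morphisms `X ⟶ F⟦n⟧` for small `n`. -/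
lemma exists_vanishing_bound (hF : DerivedCategory.TStructure.t.bounded F)
    {X : DerivedCategory A} (hX : DerivedCategory.TStructure.t.bounded X) :
    ∃ b : ℤ, (∀ n, b < n → ∀ x : Ψ n ⟶ X, x = 0) ∧ (∀ n, n < -b → ∀ x : X ⟶ Ψ n, x = 0) := by
  obtain ⟨⟨a, _⟩, ⟨c, _⟩⟩ := hF
  obtain ⟨⟨a', _⟩, ⟨c', _⟩⟩ := hX
  have hF1 : F.IsGE a := ‹_›
  have hF2 : F.IsLE c := ‹_›
  have hX1 : X.IsGE a' := ‹_›
  have hX2 : X.IsLE c' := ‹_›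
  refine ⟨max (c - a') (c' - a), fun n hn x => ?_, fun n hn x => ?_⟩
  · have : (F⟦n⟧).IsLE (c - n) := DerivedCategory.TStructure.t.isLE_shift F c n (c - n) (by omega)
    rw [← cancel_epi (θ n).inv, comp_zero]
    exact DerivedCategory.TStructure.t.zero _ (c - n) a' (by omega)
  · have : (F⟦n⟧).IsGE (a - n) := DerivedCategory.TStructure.t.isGE_shift F a n (a - n) (by omega)
    rw [← cancel_mono (θ n).hom, zero_comp]
    exact DerivedCategory.TStructure.t.zero _ c' (a - n) (by omega)

end Duality

end

end SphericalTwist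

/-! ### K-injective complexes -/

namespace SphericalTwist

noncomputable section

section KInjective

variable {A : Type u} [Category.{v} A] [Abelian A]

instance isKInjective_biproduct {J : Type} [Finite J] (X : J → CochainComplex A ℤ)
    [HasBiproduct X] [∀ j, (X j).IsKInjective] : (⨁ X).IsKInjective where
  nonempty_homotopy_zero {K} f hK := by
    cases nonempty_fintype J
    refine ⟨HomotopyCategory.homotopyOfEq _ _ ?_⟩
    have h (j : J) : (HomotopyCategory.quotient A (ComplexShape.up ℤ)).map
        (f ≫ biproduct.π X j) = 0 := by
      rw [HomotopyCategory.eq_of_homotopy _ _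
        (CochainComplex.IsKInjective.homotopyZero (f ≫ biproduct.π X j) hK), Functor.map_zero]
    rw [← Category.comp_id f, ← biproduct.total, Preadditive.comp_sum, Functor.map_sum,
      Functor.map_zero]
    refine Finset.sum_eq_zero fun j _ => ?_
    rw [← Category.assoc, Functor.map_comp, h, zero_comp]

open Pretriangulated in
instance isKInjective_mappingCone {K L : CochainComplex A ℤ} (φ : K ⟶ L) [K.IsKInjective]
    [hL : L.IsKInjective] : (CochainComplex.mappingCone φ).IsKInjective := by
  rw [CochainComplex.isKInjective_iff_rightOrthogonal] at hL ⊢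
  have hK := CochainComplex.IsKInjective.rightOrthogonal (K⟦(1 : ℤ)⟧)
  have hT := HomotopyCategory.mappingCone_triangleh_distinguished φ
  have := ObjectProperty.ext_of_isTriangulatedClosed₂
    (HomotopyCategory.subcategoryAcyclic A).rightOrthogonal _ (rot_of_distTriang _ hT) hL
    (ObjectProperty.prop_of_iso _
      (((HomotopyCategory.quotient A (.up ℤ)).commShiftIso (1 : ℤ)).app K) hK)
  exact this

instance isKInjective_mappingCocone {K L : CochainComplex A ℤ} (φ : K ⟶ L) [K.IsKInjective]
    [L.IsKInjective] : (CochainComplex.mappingCocone φ).IsKInjective :=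
  inferInstanceAs ((CochainComplex.mappingCone φ)⟦(-1 : ℤ)⟧).IsKInjective

variable [HasDerivedCategory.{w} A]

lemma exists_Q_map_eq {K G : CochainComplex A ℤ} [G.IsKInjective]
    (φ : DerivedCategory.Q.obj K ⟶ DerivedCategory.Q.obj G) :
    ∃ f : K ⟶ G, DerivedCategory.Q.map f = φ := by
  obtain ⟨g, hg⟩ := (CochainComplex.IsKInjective.Qh_map_bijective _ G).surjective
    ((DerivedCategory.quotientCompQhIso A).hom.app K ≫ φ ≫
      (DerivedCategory.quotientCompQhIso A).inv.app G)
  obtain ⟨f, rfl⟩ := (HomotopyCategory.quotient A (.up ℤ)).map_surjective g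
  refine ⟨f, ?_⟩
  rw [← cancel_epi ((DerivedCategory.quotientCompQhIso A).hom.app K),
    ← DerivedCategory.quotientCompQhIso_hom_naturality, hg]
  simp

lemma nonempty_homotopy_of_Q_map_eq {K G : CochainComplex A ℤ} [G.IsKInjective] {f g : K ⟶ G}
    (h : DerivedCategory.Q.map f = DerivedCategory.Q.map g) : Nonempty (Homotopy f g) := by
  refine ⟨HomotopyCategory.homotopyOfEq _ _
    ((CochainComplex.IsKInjective.Qh_map_bijective _ G).injective ?_)⟩
  rw [← cancel_mono ((DerivedCategory.quotientCompQhIso A).hom.app G),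
    DerivedCategory.quotientCompQhIso_hom_naturality,
    DerivedCategory.quotientCompQhIso_hom_naturality, h]

lemma Q_map_eq_of_homotopy {K G : CochainComplex A ℤ} {f g : K ⟶ G} (h : Homotopy f g) :
    DerivedCategory.Q.map f = DerivedCategory.Q.map g := by
  rw [← cancel_epi ((DerivedCategory.quotientCompQhIso A).hom.app K),
    ← DerivedCategory.quotientCompQhIso_hom_naturality,
    ← DerivedCategory.quotientCompQhIso_hom_naturality, HomotopyCategory.eq_of_homotopy _ _ h]

/-- Bounded below complexes have K-injective resolutions. -/
lemma exists_isKInjective_iso [EnoughInjectives A] {X : DerivedCategory A}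
    (hX : DerivedCategory.TStructure.t.bounded X) :
    ∃ G : CochainComplex A ℤ, G.IsKInjective ∧ Nonempty (DerivedCategory.Q.obj G ≅ X) := by
  obtain ⟨⟨a, _⟩, -⟩ := hX
  have : X.IsGE a := ‹_›
  obtain ⟨K, hK, ⟨e⟩⟩ := DerivedCategory.exists_iso_Q_obj_of_isGE X a
  obtain ⟨L, i, _, hL, _⟩ := CochainComplex.Plus.modelCategoryQuillen.exists_quasiIso_injective K a
  exact ⟨L, CochainComplex.isKInjective_of_injective L a,
    ⟨(asIso (DerivedCategory.Q.map i)).symm ≪≫ e.symm⟩⟩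

end KInjective

section Membership

variable {A : Type u} [Category.{v} A] [Abelian A] [HasDerivedCategory.{w} A]
  (P : ObjectProperty (DerivedCategory A)) [P.IsTriangulated] [P.IsClosedUnderIsomorphisms]

lemma sum_Q_map_π_comp_Q_map_ι {J : Type} [Fintype J] (X : J → CochainComplex A ℤ)
    [HasBiproduct X] :
    ∑ j, DerivedCategory.Q.map (biproduct.π X j) ≫ DerivedCategory.Q.map (biproduct.ι X j) =
      𝟙 (DerivedCategory.Q.obj (⨁ X)) := by
  simp only [← Functor.map_comp, ← Functor.map_sum]
  rw [biproduct.total, CategoryTheory.Functor.map_id]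

lemma prop_Q_biproduct {J : Type} [Finite J] (X : J → CochainComplex A ℤ) [HasBiproduct X]
    (h : ∀ j, P (DerivedCategory.Q.obj (X j))) : P (DerivedCategory.Q.obj (⨁ X)) :=
  P.prop_of_isLimit_fan
    (isBilimitOfPreserves DerivedCategory.Q (biproduct.isBilimit X)).isLimit h

lemma prop_Q_shift {K : CochainComplex A ℤ} (hK : P (DerivedCategory.Q.obj K)) (n : ℤ) :
    P (DerivedCategory.Q.obj (K⟦n⟧)) :=
  P.prop_of_iso ((DerivedCategory.Q.commShiftIso n).symm.app K) (P.le_shift n _ hK)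

lemma prop_Q_mappingCone {K L : CochainComplex A ℤ} (φ : K ⟶ L)
    (hK : P (DerivedCategory.Q.obj K)) (hL : P (DerivedCategory.Q.obj L)) :
    P (DerivedCategory.Q.obj (CochainComplex.mappingCone φ)) :=
  P.ext_of_isTriangulatedClosed₃ _ (DerivedCategory.mappingCone_triangle_distinguished φ) hK hL

end Membership

end

end SphericalTwist

/-! ### Morphisms of mapping cones -/

namespace SphericalTwist

noncomputable section

open Pretriangulated CochainComplex DerivedCategory

section ConeMap

variable {A : Type u} [Category.{v} A] [Abelian A]

/-- The third morphism `mappingCone φ ⟶ K⟦1⟧` of the standard triangle of `φ : K ⟶ L`. -/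
def coneδ {K L : CochainComplex A ℤ} (φ : K ⟶ L) : mappingCone φ ⟶ K⟦(1 : ℤ)⟧ :=
  (mappingCone.triangle φ).mor₃

section

variable {K L M : CochainComplex A ℤ} (φ : K ⟶ L)

lemma inl_v_coneδ_f (p q : ℤ) (h : p + (-1) = q) :
    (mappingCone.inl φ).v p q h ≫ (coneδ φ).f q =
      -(K.shiftFunctorObjXIso 1 q p (by omega)).inv :=
  mappingCone.inl_v_triangle_mor₃_f φ p q h

lemma inr_f_coneδ_f (p : ℤ) : (mappingCone.inr φ).f p ≫ (coneδ φ).f p = 0 :=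
  mappingCone.inr_f_triangle_mor₃_f φ p

@[simp]
lemma inr_coneδ : mappingCone.inr φ ≫ coneδ φ = 0 :=
  mappingCone.inr_triangleδ φ

lemma fst_v_eq (p q : ℤ) (h : p + 1 = q) : (mappingCone.fst φ).1.v p q h =
    -((coneδ φ).f p ≫ (K.shiftFunctorObjXIso 1 p q h.symm).hom) := by
  rw [mappingCone.ext_from_iff φ q p h]
  simp only [mappingCone.inl_v_fst_v, mappingCone.inr_f_fst_v, Preadditive.comp_neg,
    reassoc_of% (inl_v_coneδ_f φ q p), reassoc_of% (inr_f_coneδ_f φ), zero_comp, neg_zero, and_true]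
  rw [Preadditive.neg_comp, Iso.inv_hom_id, neg_neg]

lemma mono_inr_f (p : ℤ) : Mono ((mappingCone.inr φ).f p) :=
  mono_of_mono_fac (mappingCone.inr_f_snd_v φ p)

lemma epi_coneδ_f (p : ℤ) : Epi ((coneδ φ).f p) :=
  epi_of_epi_fac (inl_v_coneδ_f φ (p + 1) p (add_neg_cancel_right p 1))

instance mono_inr : Mono (mappingCone.inr φ) :=
  have := mono_inr_f φ
  HomologicalComplex.mono_of_mono_f _ this

instance epi_coneδ : Epi (coneδ φ) :=
  have := epi_coneδ_f φ
  HomologicalComplex.epi_of_epi_f _ this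

/-- The morphism `L ⟶ mappingCone φ` is the kernel of `mappingCone φ ⟶ K⟦1⟧`. -/
lemma exists_eq_comp_inr (d : M ⟶ mappingCone φ) (hd : d ≫ coneδ φ = 0) :
    ∃ x : M ⟶ L, d = x ≫ mappingCone.inr φ := by
  have h (p : ℤ) : (d.f p ≫ (mappingCone.snd φ).v p p (add_zero p)) ≫ (mappingCone.inr φ).f p =
      d.f p := by
    have hp : d.f p ≫ (coneδ φ).f p = 0 := HomologicalComplex.congr_hom hd p
    rw [mappingCone.ext_to_iff φ p (p + 1) rfl]
    constructor
    · rw [fst_v_eq, Preadditive.comp_neg, Preadditive.comp_neg, Category.assoc,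
        reassoc_of% (inr_f_coneδ_f φ), zero_comp, comp_zero, reassoc_of% hp, zero_comp]
    · simp
  refine ⟨{ f := fun p => d.f p ≫ (mappingCone.snd φ).v p p (add_zero p), comm' := ?_ }, ?_⟩
  · rintro p _ rfl
    have := mono_inr_f φ (p + 1)
    rw [← cancel_mono ((mappingCone.inr φ).f (p + 1)), Category.assoc, Category.assoc,
      Category.assoc, h, ← d.comm, ← (mappingCone.inr φ).comm, ← Category.assoc (d.f p),
      ← Category.assoc, h]
  · ext p
    exact (h p).symm

/-- The morphism `mappingCone φ ⟶ K⟦1⟧` is the cokernel of `L ⟶ mappingCone φ`. -/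
lemma exists_eq_coneδ_comp (d : mappingCone φ ⟶ M) (hd : mappingCone.inr φ ≫ d = 0) :
    ∃ x : K⟦(1 : ℤ)⟧ ⟶ M, d = coneδ φ ≫ x := by
  let x (p : ℤ) : (K⟦(1 : ℤ)⟧).X p ⟶ M.X p :=
    -((K.shiftFunctorObjXIso 1 p (p + 1) rfl).hom ≫
      (mappingCone.inl φ).v (p + 1) p (by omega) ≫ d.f p)
  have h (p : ℤ) : (coneδ φ).f p ≫ x p = d.f p := by
    have hp : (mappingCone.inr φ).f p ≫ d.f p = 0 := HomologicalComplex.congr_hom hd p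
    rw [mappingCone.ext_from_iff φ (p + 1) p rfl]
    constructor
    · rw [reassoc_of% (inl_v_coneδ_f φ)]
      simp only [x, Preadditive.neg_comp, Preadditive.comp_neg, neg_neg]
      rw [Iso.inv_hom_id_assoc]
    · rw [reassoc_of% (inr_f_coneδ_f φ), zero_comp, hp]
  refine ⟨{ f := x, comm' := ?_ }, ?_⟩
  · rintro p _ rfl
    have := epi_coneδ_f φ p
    rw [← cancel_epi ((coneδ φ).f p), ← Category.assoc, h, (coneδ φ).comm_assoc, h, d.comm]
  · ext p
    exact (h p).symm

end

/-- A morphism of mapping cones `m` which, together with `a` and `b`, makes the second and the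
third square of a morphism between the standard triangles of `φ₁` and `φ₂` commute strictly. The
morphisms induced by squares that commute up to homotopy are of this kind; unlike these, the present
condition composes without any bookkeeping of homotopies. -/
structure IsConeMap {K₁ L₁ K₂ L₂ : CochainComplex A ℤ} (φ₁ : K₁ ⟶ L₁) (φ₂ : K₂ ⟶ L₂)
    (a : K₁ ⟶ K₂) (b : L₁ ⟶ L₂) (m : mappingCone φ₁ ⟶ mappingCone φ₂) : Prop where
  inr_comp : mappingCone.inr φ₁ ≫ m = b ≫ mappingCone.inr φ₂
  comp_coneδ : m ≫ coneδ φ₂ = coneδ φ₁ ≫ a⟦(1 : ℤ)⟧'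

namespace IsConeMap

variable {K₁ L₁ K₂ L₂ K₃ L₃ : CochainComplex A ℤ} {φ₁ : K₁ ⟶ L₁} {φ₂ : K₂ ⟶ L₂} {φ₃ : K₃ ⟶ L₃}

lemma mapOfHomotopy {a : K₁ ⟶ K₂} {b : L₁ ⟶ L₂} (H : Homotopy (φ₁ ≫ b) (a ≫ φ₂)) :
    IsConeMap φ₁ φ₂ a b (mappingCone.mapOfHomotopy H) where
  inr_comp := mappingCone.triangleMapOfHomotopy_comm₂ H
  comp_coneδ := mappingCone.triangleMapOfHomotopy_comm₃ H

variable (φ₁) in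
lemma id : IsConeMap φ₁ φ₁ (𝟙 _) (𝟙 _) (𝟙 _) where
  inr_comp := by simp
  comp_coneδ := by rw [CategoryTheory.Functor.map_id]; simp

lemma comp {a : K₁ ⟶ K₂} {b : L₁ ⟶ L₂} {m : mappingCone φ₁ ⟶ mappingCone φ₂}
    {a' : K₂ ⟶ K₃} {b' : L₂ ⟶ L₃} {m' : mappingCone φ₂ ⟶ mappingCone φ₃}
    (h : IsConeMap φ₁ φ₂ a b m) (h' : IsConeMap φ₂ φ₃ a' b' m') :
    IsConeMap φ₁ φ₃ (a ≫ a') (b ≫ b') (m ≫ m') where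
  inr_comp := by rw [← Category.assoc, h.inr_comp, Category.assoc, h'.inr_comp, Category.assoc]
  comp_coneδ := by
    rw [Category.assoc, h'.comp_coneδ, ← Category.assoc, h.comp_coneδ, Category.assoc,
      Functor.map_comp]

end IsConeMap

variable [HasDerivedCategory.{w} A]

lemma Q_cone_distinguished {K L : CochainComplex A ℤ} (φ : K ⟶ L) :
    Triangle.mk (Q.map φ) (Q.map (mappingCone.inr φ))
      (Q.map (coneδ φ) ≫ (Q.commShiftIso (1 : ℤ)).hom.app K) ∈ distTriang (DerivedCategory A) :=
  mappingCone_triangle_distinguished φ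

lemma Q_map_comp_Q_map_inr {K L : CochainComplex A ℤ} (φ : K ⟶ L) :
    Q.map φ ≫ Q.map (mappingCone.inr φ) = 0 :=
  comp_distTriang_mor_zero₁₂ _ (Q_cone_distinguished φ)

lemma Q_map_coneδ_comp_Q_map_shift {K L : CochainComplex A ℤ} (φ : K ⟶ L) :
    Q.map (coneδ φ) ≫ Q.map (φ⟦(1 : ℤ)⟧') = 0 := by
  have h : (Q.map (coneδ φ) ≫ (Q.commShiftIso (1 : ℤ)).hom.app K) ≫ (Q.map φ)⟦(1 : ℤ)⟧' = 0 :=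
    comp_distTriang_mor_zero₃₁ _ (Q_cone_distinguished φ)
  rw [Category.assoc] at h
  have h2 : Q.map (φ⟦(1 : ℤ)⟧') ≫ (Q.commShiftIso (1 : ℤ)).hom.app L =
    (Q.commShiftIso (1 : ℤ)).hom.app K ≫ (Q.map φ)⟦(1 : ℤ)⟧' :=
    (Q.commShiftIso (1 : ℤ)).hom.naturality φ
  rw [← cancel_mono ((Q.commShiftIso (1 : ℤ)).hom.app L), Category.assoc, h2, h, zero_comp]

lemma exists_eq_Q_map_coneδ_comp {K L : CochainComplex A ℤ} (φ : K ⟶ L) {W : DerivedCategory A}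
    (x : Q.obj (mappingCone φ) ⟶ W) (hx : Q.map (mappingCone.inr φ) ≫ x = 0) :
    ∃ y : Q.obj (K⟦(1 : ℤ)⟧) ⟶ W, x = Q.map (coneδ φ) ≫ y := by
  obtain ⟨y, hy⟩ := exists_eq_mor₃_comp (Q_cone_distinguished φ) x hx
  exact ⟨(Q.commShiftIso (1 : ℤ)).hom.app K ≫ y, by rw [hy, Category.assoc]⟩

lemma exists_eq_comp_Q_map_inr {K L : CochainComplex A ℤ} (φ : K ⟶ L) {W : DerivedCategory A}
    (x : W ⟶ Q.obj (mappingCone φ)) (hx : x ≫ Q.map (coneδ φ) = 0) :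
    ∃ y : W ⟶ Q.obj L, x = y ≫ Q.map (mappingCone.inr φ) := by
  refine exists_eq_comp_mor₂ (Q_cone_distinguished φ) x ?_
  rw [← Category.assoc, hx, zero_comp]

variable {K₁ L₁ K₂ L₂ : CochainComplex A ℤ} {φ₁ : K₁ ⟶ L₁} {φ₂ : K₂ ⟶ L₂}

/-- Two morphisms of cones that agree on the first objects and whose restrictions to the second
objects have the same class differ by a morphism that factors through `K₁⟦1⟧ ⟶ L₂`; if these all
factor through `φ₂`, the difference vanishes in the derived category. -/
lemma IsConeMap.Q_map_eq_of_left_eq {a : K₁ ⟶ K₂} {b b' : L₁ ⟶ L₂}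
    {m m' : mappingCone φ₁ ⟶ mappingCone φ₂} (hm : IsConeMap φ₁ φ₂ a b m)
    (hm' : IsConeMap φ₁ φ₂ a b' m') (hb : Q.map b = Q.map b')
    (hφ₂ : ∀ u : Q.obj (K₁⟦(1 : ℤ)⟧) ⟶ Q.obj L₂, ∃ y, u = y ≫ Q.map φ₂) :
    Q.map m = Q.map m' := by
  obtain ⟨x, hx⟩ := exists_eq_comp_inr φ₂ (m - m') (by
    rw [Preadditive.sub_comp, hm.comp_coneδ, hm'.comp_coneδ, sub_self])
  have h1 : mappingCone.inr φ₁ ≫ x = b - b' := by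
    rw [← cancel_mono (mappingCone.inr φ₂), Category.assoc, ← hx, Preadditive.comp_sub,
      hm.inr_comp, hm'.inr_comp, Preadditive.sub_comp]
  obtain ⟨u, hu⟩ := exists_eq_Q_map_coneδ_comp φ₁ (Q.map x) (by
    rw [← Functor.map_comp, h1, Functor.map_sub, hb, sub_self])
  obtain ⟨y, rfl⟩ := hφ₂ u
  rw [← sub_eq_zero, ← Functor.map_sub, hx, Functor.map_comp, hu, Category.assoc, Category.assoc,
    Q_map_comp_Q_map_inr, comp_zero, comp_zero]

/-- Two morphisms of cones that agree on the second objects and whose restrictions to the first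
objects have the same class differ by a morphism that factors through `K₁⟦1⟧ ⟶ L₂`; if these all
factor through `φ₁⟦1⟧`, the difference vanishes in the derived category. -/
lemma IsConeMap.Q_map_eq_of_right_eq {a a' : K₁ ⟶ K₂} {b : L₁ ⟶ L₂}
    {m m' : mappingCone φ₁ ⟶ mappingCone φ₂} (hm : IsConeMap φ₁ φ₂ a b m)
    (hm' : IsConeMap φ₁ φ₂ a' b m') (ha : Q.map (a⟦(1 : ℤ)⟧') = Q.map (a'⟦(1 : ℤ)⟧'))
    (hφ₁ : ∀ u : Q.obj (K₁⟦(1 : ℤ)⟧) ⟶ Q.obj L₂, ∃ y, u = Q.map (φ₁⟦(1 : ℤ)⟧') ≫ y) :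
    Q.map m = Q.map m' := by
  obtain ⟨x, hx⟩ := exists_eq_coneδ_comp φ₁ (m - m') (by
    rw [Preadditive.comp_sub, hm.inr_comp, hm'.inr_comp, sub_self])
  have h1 : x ≫ coneδ φ₂ = a⟦(1 : ℤ)⟧' - a'⟦(1 : ℤ)⟧' := by
    rw [← cancel_epi (coneδ φ₁), ← Category.assoc, ← hx, Preadditive.sub_comp,
      hm.comp_coneδ, hm'.comp_coneδ, Preadditive.comp_sub]
  obtain ⟨u, hu⟩ := exists_eq_comp_Q_map_inr φ₂ (Q.map x) (by
    rw [← Functor.map_comp, h1, Functor.map_sub, ha, sub_self])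
  obtain ⟨y, rfl⟩ := hφ₁ u
  rw [← sub_eq_zero, ← Functor.map_sub, hx, Functor.map_comp, hu, ← Category.assoc,
    ← Category.assoc, Q_map_coneδ_comp_Q_map_shift, zero_comp, zero_comp]

end ConeMap

end

end SphericalTwist

/-! ### Bases of morphisms and the maps that they induce -/

namespace SphericalTwist

noncomputable section

open Pretriangulated CochainComplex DerivedCategory

variable {k : Type t} [Field k] {A : Type u} [Category.{v} A] [Abelian A] [Linear k A]
  [HasDerivedCategory.{w} A]

section Shift

variable (k) in
/-- The shift on the derived category as a map on morphisms between classes of complexes. -/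
def QShift (K L : CochainComplex A ℤ) (n : ℤ) :
    (Q.obj K ⟶ Q.obj L) ≃ₗ[k] (Q.obj (K⟦n⟧) ⟶ Q.obj (L⟦n⟧)) :=
  shiftHomEquiv k _ _ n ≪≫ₗ Linear.homCongr k ((Q.commShiftIso n).symm.app K)
    ((Q.commShiftIso n).symm.app L)

lemma QShift_Q_map {K L : CochainComplex A ℤ} (n : ℤ) (f : K ⟶ L) :
    QShift k K L n (Q.map f) = Q.map (f⟦n⟧') := by
  simp [QShift, Linear.homCongr_apply]

lemma Q_map_shift_eq {K L : CochainComplex A ℤ} (n : ℤ) {f g : K ⟶ L} (h : Q.map f = Q.map g) :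
    Q.map (f⟦n⟧') = Q.map (g⟦n⟧') := by
  rw [← cancel_mono ((Q.commShiftIso n).hom.app L), Functor.commShiftIso_hom_naturality, h,
    Functor.commShiftIso_hom_naturality]

end Shift

section Biproduct

variable {J : Type} [Finite J] (X : J → CochainComplex A ℤ) [HasBiproduct X]

lemma Q_biproduct_hom_ext_from {W : DerivedCategory A} {f g : Q.obj (⨁ X) ⟶ W}
    (h : ∀ j, Q.map (biproduct.ι X j) ≫ f = Q.map (biproduct.ι X j) ≫ g) : f = g := by
  cases nonempty_fintype J
  rw [← Category.id_comp f, ← Category.id_comp g, ← sum_Q_map_π_comp_Q_map_ι,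
    Preadditive.sum_comp, Preadditive.sum_comp]
  exact Finset.sum_congr rfl fun j _ => by rw [Category.assoc, h, Category.assoc]

lemma Q_biproduct_hom_ext_to {W : DerivedCategory A} {f g : W ⟶ Q.obj (⨁ X)}
    (h : ∀ j, f ≫ Q.map (biproduct.π X j) = g ≫ Q.map (biproduct.π X j)) : f = g := by
  cases nonempty_fintype J
  rw [← Category.comp_id f, ← Category.comp_id g, ← sum_Q_map_π_comp_Q_map_ι,
    Preadditive.comp_sum, Preadditive.comp_sum]
  exact Finset.sum_congr rfl fun j _ => by rw [← Category.assoc, h, Category.assoc]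

/-- A family of factorizations of the components of a morphism from a sum gives a factorization of
the morphism. -/
lemma exists_eq_comp_of_forall_ι (n : ℤ) {W V : DerivedCategory A} (g : V ⟶ W)
    (u : Q.obj ((⨁ X)⟦n⟧) ⟶ W)
    (h : ∀ j, ∃ y, Q.map ((biproduct.ι X j)⟦n⟧') ≫ u = y ≫ g) : ∃ y, u = y ≫ g := by
  cases nonempty_fintype J
  choose y hy using h
  refine ⟨∑ j, Q.map ((biproduct.π X j)⟦n⟧') ≫ y j, ?_⟩
  rw [Preadditive.sum_comp]
  simp only [Category.assoc, ← hy]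
  simp only [← Category.assoc, ← Functor.map_comp]
  rw [← Preadditive.sum_comp, ← Functor.map_sum, ← Functor.map_sum, biproduct.total,
    CategoryTheory.Functor.map_id, CategoryTheory.Functor.map_id, Category.id_comp]

lemma exists_eq_comp_of_forall_π {W V : DerivedCategory A} (g : W ⟶ V) (u : W ⟶ Q.obj (⨁ X))
    (h : ∀ j, ∃ y, u ≫ Q.map (biproduct.π X j) = g ≫ y) : ∃ y, u = g ≫ y := by
  cases nonempty_fintype J
  choose y hy using h
  refine ⟨∑ j, y j ≫ Q.map (biproduct.ι X j), ?_⟩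
  rw [Preadditive.comp_sum]
  simp only [← Category.assoc, ← hy]
  simp only [Category.assoc]
  rw [← Preadditive.comp_sum, sum_Q_map_π_comp_Q_map_ι, Category.comp_id]

end Biproduct

namespace EvalBasis

variable {F G G' G'' : CochainComplex A ℤ} (B : EvalBasis k F G) (B' : EvalBasis k F G')
  (B'' : EvalBasis k F G'')

@[simp]
lemma ι_ev (n : ℤ) (j : B.ι n) :
    biproduct.ι (fun p : (Σ n, B.ι n) => F⟦p.1⟧) ⟨n, j⟩ ≫ B.ev = B.e n j :=
  biproduct.ι_desc _ _

lemma ι_tensorMap (a : ∀ n, B.ι n → B'.ι n → k) (n : ℤ) (i : B.ι n) :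
    biproduct.ι (fun p : (Σ n, B.ι n) => F⟦p.1⟧) ⟨n, i⟩ ≫ B.tensorMap B' a =
      ∑ j, a n i j • biproduct.ι (fun p : (Σ n, B'.ι n) => F⟦p.1⟧) ⟨n, j⟩ :=
  biproduct.ι_desc _ _

lemma ι_tensorMap_ev (a : ∀ n, B.ι n → B'.ι n → k) (n : ℤ) (i : B.ι n) :
    biproduct.ι (fun p : (Σ n, B.ι n) => F⟦p.1⟧) ⟨n, i⟩ ≫ B.tensorMap B' a ≫ B'.ev =
      ∑ j, a n i j • B'.e n j := by
  rw [← Category.assoc, ι_tensorMap, Preadditive.sum_comp]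
  exact Finset.sum_congr rfl fun j _ => by rw [Linear.smul_comp, ι_ev]

lemma exists_eq_sum {n : ℤ} (x : Q.obj (F⟦n⟧) ⟶ Q.obj G) :
    ∃ c : B.ι n → k, x = ∑ j, c j • Q.map (B.e n j) := by
  have hx : x ∈ Submodule.span k (Set.range fun j : B.ι n => Q.map (B.e n j)) :=
    B.span_eq_top n ▸ Submodule.mem_top
  obtain ⟨c, hc⟩ := (Submodule.mem_span_range_iff_exists_fun k).1 hx
  exact ⟨c, hc.symm⟩

lemma exists_tensorMap (φ : Q.obj G ⟶ Q.obj G') : ∃ a : ∀ n, B.ι n → B'.ι n → k,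
    Q.map B.ev ≫ φ = Q.map (B.tensorMap B' a ≫ B'.ev) := by
  choose a ha using fun n (i : B.ι n) => B'.exists_eq_sum (Q.map (B.e n i) ≫ φ)
  refine ⟨a, Q_biproduct_hom_ext_from _ ?_⟩
  rintro ⟨n, i⟩
  rw [← Functor.map_comp, ι_tensorMap_ev, ← Category.assoc, ← Functor.map_comp, ι_ev, ha,
    Functor.map_sum]
  exact Finset.sum_congr rfl fun j _ => by rw [Functor.map_smul]

lemma tensorMap_injective {a a' : ∀ n, B.ι n → B'.ι n → k}
    (h : Q.map (B.tensorMap B' a ≫ B'.ev) = Q.map (B.tensorMap B' a' ≫ B'.ev)) : a = a' := by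
  funext n i
  have h1 : Q.map (∑ j, a n i j • B'.e n j) = Q.map (∑ j, a' n i j • B'.e n j) := by
    rw [← ι_tensorMap_ev, ← ι_tensorMap_ev, Functor.map_comp, h, ← Functor.map_comp]
  simp only [Functor.map_sum, Functor.map_smul] at h1
  have h2 := Fintype.linearIndependent_iff.1 (B'.linearIndependent n) (a n i - a' n i) (by
    simp only [Pi.sub_apply, sub_smul, Finset.sum_sub_distrib, h1, sub_self])
  funext j
  exact sub_eq_zero.1 (h2 j)

open Classical in
lemma tensorMap_id : B.tensorMap B (fun _ i j => if i = j then 1 else 0) = 𝟙 _ := by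
  refine biproduct.hom_ext' _ _ ?_
  rintro ⟨n, i⟩
  rw [ι_tensorMap, Category.comp_id]
  simp

lemma tensorMap_comp (a : ∀ n, B.ι n → B'.ι n → k) (a' : ∀ n, B'.ι n → B''.ι n → k) :
    B.tensorMap B' a ≫ B'.tensorMap B'' a' =
      B.tensorMap B'' (fun n i l => ∑ j, a n i j * a' n j l) := by
  refine biproduct.hom_ext' _ _ ?_
  rintro ⟨n, i⟩
  rw [← Category.assoc, ι_tensorMap, ι_tensorMap, Preadditive.sum_comp]
  simp only [Linear.smul_comp, ι_tensorMap, Finset.smul_sum, Finset.sum_smul, mul_smul]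
  exact Finset.sum_comm

/-- Every morphism from the shifted sum `(F ⊗ RHom(F, G))⟦1⟧` to `G'` factors through the
evaluation `F ⊗ RHom(F, G') ⟶ G'`. -/
lemma exists_eq_comp_ev (u : Q.obj (B.tensor⟦(1 : ℤ)⟧) ⟶ Q.obj G') :
    ∃ y, u = y ≫ Q.map B'.ev := by
  refine exists_eq_comp_of_forall_ι _ _ _ _ ?_
  rintro ⟨n, i⟩
  let s : F⟦n⟧⟦(1 : ℤ)⟧ ≅ F⟦n + 1⟧ := (CategoryTheory.shiftFunctorAdd _ n 1).symm.app F
  obtain ⟨c, hc⟩ := B'.exists_eq_sum (Q.map s.inv ≫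
    Q.map ((biproduct.ι (fun p : (Σ n, B.ι n) => F⟦p.1⟧) ⟨n, i⟩)⟦(1 : ℤ)⟧') ≫ u)
  refine ⟨Q.map s.hom ≫
    ∑ j, c j • Q.map (biproduct.ι (fun p : (Σ n, B'.ι n) => F⟦p.1⟧) ⟨n + 1, j⟩), ?_⟩
  have hs : Q.map s.hom ≫ Q.map s.inv = 𝟙 _ := by
    rw [← Functor.map_comp, s.hom_inv_id, CategoryTheory.Functor.map_id]
  rw [Category.assoc, Preadditive.sum_comp]
  simp only [Linear.smul_comp, ← Functor.map_comp, ι_ev]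
  rw [← hc, reassoc_of% hs]

/-- The relation between a morphism `φ` of the derived category and the morphism `ψ` that the twist
assigns to it, if bases are chosen on both sides. -/
def IsTwistMap (φ : Q.obj G ⟶ Q.obj G') (ψ : Q.obj B.cone ⟶ Q.obj B'.cone) : Prop :=
  ∃ (f : G ⟶ G') (a : ∀ n, B.ι n → B'.ι n → k) (m : B.cone ⟶ B'.cone),
    Q.map f = φ ∧ Q.map m = ψ ∧ Q.map (B.ev ≫ f) = Q.map (B.tensorMap B' a ≫ B'.ev) ∧
      IsConeMap B.ev B'.ev (B.tensorMap B' a) f m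

variable {B B' B''}

lemma isTwistMap_mapOfHomotopy {f : G ⟶ G'} {a : ∀ n, B.ι n → B'.ι n → k}
    (H : Homotopy (B.ev ≫ f) (B.tensorMap B' a ≫ B'.ev)) :
    IsTwistMap B B' (Q.map f) (Q.map (mappingCone.mapOfHomotopy H)) :=
  ⟨f, a, _, rfl, rfl, Q_map_eq_of_homotopy H, .mapOfHomotopy H⟩

lemma exists_homotopy [G'.IsKInjective] (φ : Q.obj G ⟶ Q.obj G') :
    ∃ (f : G ⟶ G') (a : ∀ n, B.ι n → B'.ι n → k),
      Q.map f = φ ∧ Nonempty (Homotopy (B.ev ≫ f) (B.tensorMap B' a ≫ B'.ev)) := by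
  obtain ⟨f, rfl⟩ := exists_Q_map_eq φ
  obtain ⟨a, ha⟩ := exists_tensorMap B B' (Q.map f)
  exact ⟨f, a, rfl, nonempty_homotopy_of_Q_map_eq (by rw [Functor.map_comp, ha])⟩

lemma exists_isTwistMap [G'.IsKInjective] (φ : Q.obj G ⟶ Q.obj G') :
    ∃ ψ, IsTwistMap B B' φ ψ := by
  obtain ⟨f, a, rfl, ⟨H⟩⟩ := exists_homotopy (B := B) (B' := B') φ
  exact ⟨_, isTwistMap_mapOfHomotopy H⟩

lemma IsTwistMap.unique {φ : Q.obj G ⟶ Q.obj G'} {ψ ψ' : Q.obj B.cone ⟶ Q.obj B'.cone}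
    (h : IsTwistMap B B' φ ψ) (h' : IsTwistMap B B' φ ψ') : ψ = ψ' := by
  obtain ⟨f, a, m, hf, rfl, ha, hm⟩ := h
  obtain ⟨f', a', m', hf', rfl, ha', hm'⟩ := h'
  obtain rfl : a = a' := tensorMap_injective B B' (by
    rw [← ha, ← ha', Functor.map_comp, Functor.map_comp, hf, hf'])
  exact hm.Q_map_eq_of_left_eq hm' (hf.trans hf'.symm) (exists_eq_comp_ev B B')

variable (B) in
lemma IsTwistMap.id : IsTwistMap B B (𝟙 _) (𝟙 _) := by
  classical
  refine ⟨𝟙 _, fun _ i j => if i = j then 1 else 0, 𝟙 _, Q.map_id _, Q.map_id _, ?_, ?_⟩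
  · rw [tensorMap_id, Category.id_comp, Category.comp_id]
  · rw [tensorMap_id]
    exact IsConeMap.id _

lemma IsTwistMap.comp {φ : Q.obj G ⟶ Q.obj G'} {ψ : Q.obj B.cone ⟶ Q.obj B'.cone}
    {φ' : Q.obj G' ⟶ Q.obj G''} {ψ' : Q.obj B'.cone ⟶ Q.obj B''.cone}
    (h : IsTwistMap B B' φ ψ) (h' : IsTwistMap B' B'' φ' ψ') :
    IsTwistMap B B'' (φ ≫ φ') (ψ ≫ ψ') := by
  obtain ⟨f, a, m, rfl, rfl, ha, hm⟩ := h
  obtain ⟨f', a', m', rfl, rfl, ha', hm'⟩ := h'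
  refine ⟨f ≫ f', fun n i l => ∑ j, a n i j * a' n j l, m ≫ m', Q.map_comp _ _, Q.map_comp _ _,
    ?_, ?_⟩
  · rw [← tensorMap_comp, ← Category.assoc, Functor.map_comp, ha, ← Functor.map_comp,
      Category.assoc, Functor.map_comp, ha', ← Functor.map_comp, Category.assoc]
  · rw [← tensorMap_comp]
    exact hm.comp hm'

end EvalBasis

namespace CoevBasis

variable {F G G' G'' : CochainComplex A ℤ} (B : CoevBasis k F G) (B' : CoevBasis k F G')
  (B'' : CoevBasis k F G'')

@[simp]
lemma coev_π (n : ℤ) (j : B.ι n) :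
    B.coev ≫ biproduct.π (fun p : (Σ n, B.ι n) => F⟦p.1⟧) ⟨n, j⟩ = B.e n j :=
  biproduct.lift_π _ _

lemma tensorMap_π (a : ∀ n, B'.ι n → B.ι n → k) (n : ℤ) (i : B'.ι n) :
    B.tensorMap B' a ≫ biproduct.π (fun p : (Σ n, B'.ι n) => F⟦p.1⟧) ⟨n, i⟩ =
      ∑ j, a n i j • biproduct.π (fun p : (Σ n, B.ι n) => F⟦p.1⟧) ⟨n, j⟩ :=
  biproduct.lift_π _ _

lemma coev_tensorMap_π (a : ∀ n, B'.ι n → B.ι n → k) (n : ℤ) (i : B'.ι n) :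
    (B.coev ≫ B.tensorMap B' a) ≫ biproduct.π (fun p : (Σ n, B'.ι n) => F⟦p.1⟧) ⟨n, i⟩ =
      ∑ j, a n i j • B.e n j := by
  rw [Category.assoc, tensorMap_π, Preadditive.comp_sum]
  exact Finset.sum_congr rfl fun j _ => by rw [Linear.comp_smul, coev_π]

lemma exists_eq_sum {n : ℤ} (x : Q.obj G ⟶ Q.obj (F⟦n⟧)) :
    ∃ c : B.ι n → k, x = ∑ j, c j • Q.map (B.e n j) := by
  have hx : x ∈ Submodule.span k (Set.range fun j : B.ι n => Q.map (B.e n j)) :=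
    B.span_eq_top n ▸ Submodule.mem_top
  obtain ⟨c, hc⟩ := (Submodule.mem_span_range_iff_exists_fun k).1 hx
  exact ⟨c, hc.symm⟩

lemma exists_tensorMap (φ : Q.obj G ⟶ Q.obj G') : ∃ a : ∀ n, B'.ι n → B.ι n → k,
    Q.map (B.coev ≫ B.tensorMap B' a) = φ ≫ Q.map B'.coev := by
  choose a ha using fun n (i : B'.ι n) => B.exists_eq_sum (φ ≫ Q.map (B'.e n i))
  refine ⟨a, Q_biproduct_hom_ext_to _ ?_⟩
  rintro ⟨n, i⟩
  rw [← Functor.map_comp, coev_tensorMap_π, Category.assoc, ← Functor.map_comp, coev_π, ha,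
    Functor.map_sum]
  exact Finset.sum_congr rfl fun j _ => by rw [Functor.map_smul]

lemma tensorMap_injective {a a' : ∀ n, B'.ι n → B.ι n → k}
    (h : Q.map (B.coev ≫ B.tensorMap B' a) = Q.map (B.coev ≫ B.tensorMap B' a')) : a = a' := by
  funext n i
  have h1 : Q.map (∑ j, a n i j • B.e n j) = Q.map (∑ j, a' n i j • B.e n j) := by
    rw [← coev_tensorMap_π, ← coev_tensorMap_π, Functor.map_comp, h, ← Functor.map_comp]
  simp only [Functor.map_sum, Functor.map_smul] at h1
  have h2 := Fintype.linearIndependent_iff.1 (B.linearIndependent n) (a n i - a' n i) (by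
    simp only [Pi.sub_apply, sub_smul, Finset.sum_sub_distrib, h1, sub_self])
  funext j
  exact sub_eq_zero.1 (h2 j)

open Classical in
lemma tensorMap_id : B.tensorMap B (fun _ i j => if i = j then 1 else 0) = 𝟙 _ := by
  refine biproduct.hom_ext _ _ ?_
  rintro ⟨n, i⟩
  rw [tensorMap_π, Category.id_comp]
  simp

lemma tensorMap_comp (a : ∀ n, B'.ι n → B.ι n → k) (a' : ∀ n, B''.ι n → B'.ι n → k) :
    B.tensorMap B' a ≫ B'.tensorMap B'' a' =
      B.tensorMap B'' (fun n i l => ∑ j, a' n i j * a n j l) := by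
  refine biproduct.hom_ext _ _ ?_
  rintro ⟨n, i⟩
  rw [Category.assoc, tensorMap_π, tensorMap_π, Preadditive.comp_sum]
  simp only [Linear.comp_smul, tensorMap_π, Finset.smul_sum, Finset.sum_smul, mul_smul]
  exact Finset.sum_comm

/-- Every morphism from `G⟦1⟧` to a sum `F ⊗ RHom(G', F)^*` factors through the shift of the
coevaluation of `G`. -/
lemma exists_eq_coev_comp (u : Q.obj (G⟦(1 : ℤ)⟧) ⟶ Q.obj B'.tensor) :
    ∃ y, u = Q.map (B.coev⟦(1 : ℤ)⟧') ≫ y := by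
  refine exists_eq_comp_of_forall_π _ _ _ ?_
  rintro ⟨n, i⟩
  let s : F⟦n⟧ ≅ F⟦n - 1⟧⟦(1 : ℤ)⟧ := (CategoryTheory.shiftFunctorAdd' _ (n - 1) 1 n (by omega)).app F
  obtain ⟨x, hx⟩ := (QShift k _ _ 1).surjective (u ≫
    Q.map (biproduct.π (fun p : (Σ n, B'.ι n) => F⟦p.1⟧) ⟨n, i⟩) ≫ Q.map s.hom)
  obtain ⟨c, rfl⟩ := B.exists_eq_sum x
  have hs : Q.map s.hom ≫ Q.map s.inv = 𝟙 _ := by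
    rw [← Functor.map_comp, s.hom_inv_id, CategoryTheory.Functor.map_id]
  refine ⟨(∑ j, c j • Q.map ((biproduct.π (fun p : (Σ n, B.ι n) => F⟦p.1⟧)
    ⟨n - 1, j⟩)⟦(1 : ℤ)⟧')) ≫ Q.map s.inv, ?_⟩
  rw [← Category.assoc, Preadditive.comp_sum]
  simp only [Linear.comp_smul, ← Functor.map_comp, coev_π]
  simp only [map_sum, map_smul, QShift_Q_map] at hx
  rw [hx, Category.assoc, Category.assoc, hs, Category.comp_id]

/-- The relation between a morphism `φ` of the derived category and the morphism `ψ` that the dual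
twist assigns to it, if bases are chosen on both sides. -/
def IsTwistMap (φ : Q.obj G ⟶ Q.obj G') (ψ : Q.obj B.cocone ⟶ Q.obj B'.cocone) : Prop :=
  ∃ (f : G ⟶ G') (a : ∀ n, B'.ι n → B.ι n → k) (m : mappingCone B.coev ⟶ mappingCone B'.coev),
    Q.map f = φ ∧ Q.map (m⟦(-1 : ℤ)⟧') = ψ ∧
      Q.map (B.coev ≫ B.tensorMap B' a) = Q.map (f ≫ B'.coev) ∧
      IsConeMap B.coev B'.coev f (B.tensorMap B' a) m

variable {B B' B''}

lemma isTwistMap_mapOfHomotopy {f : G ⟶ G'} {a : ∀ n, B'.ι n → B.ι n → k}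
    (H : Homotopy (B.coev ≫ B.tensorMap B' a) (f ≫ B'.coev)) :
    IsTwistMap B B' (Q.map f) (Q.map ((mappingCone.mapOfHomotopy H)⟦(-1 : ℤ)⟧')) :=
  ⟨f, a, _, rfl, rfl, Q_map_eq_of_homotopy H, .mapOfHomotopy H⟩

lemma exists_homotopy [F.IsKInjective] [G'.IsKInjective] (φ : Q.obj G ⟶ Q.obj G') :
    ∃ (f : G ⟶ G') (a : ∀ n, B'.ι n → B.ι n → k),
      Q.map f = φ ∧ Nonempty (Homotopy (B.coev ≫ B.tensorMap B' a) (f ≫ B'.coev)) := by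
  obtain ⟨f, rfl⟩ := exists_Q_map_eq φ
  obtain ⟨a, ha⟩ := exists_tensorMap B B' (Q.map f)
  exact ⟨f, a, rfl, nonempty_homotopy_of_Q_map_eq (by rw [ha, Functor.map_comp])⟩

lemma exists_isTwistMap [F.IsKInjective] [G'.IsKInjective] (φ : Q.obj G ⟶ Q.obj G') :
    ∃ ψ, IsTwistMap B B' φ ψ := by
  obtain ⟨f, a, rfl, ⟨H⟩⟩ := exists_homotopy (B := B) (B' := B') φ
  exact ⟨_, isTwistMap_mapOfHomotopy H⟩

lemma IsTwistMap.unique {φ : Q.obj G ⟶ Q.obj G'} {ψ ψ' : Q.obj B.cocone ⟶ Q.obj B'.cocone}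
    (h : IsTwistMap B B' φ ψ) (h' : IsTwistMap B B' φ ψ') : ψ = ψ' := by
  obtain ⟨f, a, m, hf, rfl, ha, hm⟩ := h
  obtain ⟨f', a', m', hf', rfl, ha', hm'⟩ := h'
  obtain rfl : a = a' := tensorMap_injective B B' (by
    rw [ha, ha', Functor.map_comp, Functor.map_comp, hf, hf'])
  exact Q_map_shift_eq _ (hm.Q_map_eq_of_right_eq hm' (Q_map_shift_eq _ (hf.trans hf'.symm))
    (exists_eq_coev_comp B B'))

variable (B) in
lemma IsTwistMap.id : IsTwistMap B B (𝟙 _) (𝟙 _) := by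
  classical
  refine ⟨𝟙 _, fun _ i j => if i = j then 1 else 0, 𝟙 _, Q.map_id _, ?_, ?_, ?_⟩
  · rw [CategoryTheory.Functor.map_id, CategoryTheory.Functor.map_id]
    rfl
  · rw [tensorMap_id, Category.id_comp, Category.comp_id]
  · rw [tensorMap_id]
    exact IsConeMap.id _

lemma IsTwistMap.comp {φ : Q.obj G ⟶ Q.obj G'} {ψ : Q.obj B.cocone ⟶ Q.obj B'.cocone}
    {φ' : Q.obj G' ⟶ Q.obj G''} {ψ' : Q.obj B'.cocone ⟶ Q.obj B''.cocone}
    (h : IsTwistMap B B' φ ψ) (h' : IsTwistMap B' B'' φ' ψ') :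
    IsTwistMap B B'' (φ ≫ φ') (ψ ≫ ψ') := by
  obtain ⟨f, a, m, rfl, rfl, ha, hm⟩ := h
  obtain ⟨f', a', m', rfl, rfl, ha', hm'⟩ := h'
  refine ⟨f ≫ f', fun n i l => ∑ j, a' n i j * a n j l, m ≫ m', Q.map_comp _ _, ?_, ?_, ?_⟩
  · rw [Functor.map_comp, Functor.map_comp]
    rfl
  · rw [← tensorMap_comp, ← Category.assoc, Functor.map_comp, ha, ← Functor.map_comp,
      Category.assoc, Functor.map_comp, ha', ← Functor.map_comp, Category.assoc]
  · rw [← tensorMap_comp]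
    exact hm.comp hm'

end CoevBasis

end

end SphericalTwist

/-! ### Functors defined on models -/

namespace SphericalTwist

noncomputable section

open Pretriangulated CochainComplex DerivedCategory

section Models

variable {D : Type*} [Category* D] {M : Type*} (p : M → D) (hp : ∀ X, ∃ m, Nonempty (p m ≅ X))

include hp

/-- A functorial relation between morphisms `p x ⟶ p y` and morphisms `c x ⟶ c y`, where `p` meets
all isomorphism classes, is realized by a functor that sends `p x` to `c x`. -/
lemma exists_functor_of_relation (c : M → D) (R : ∀ x y : M, (p x ⟶ p y) → (c x ⟶ c y) → Prop)
    (exists_rel : ∀ x y φ, ∃ ψ, R x y φ ψ)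
    (unique : ∀ x y φ ψ ψ', R x y φ ψ → R x y φ ψ' → ψ = ψ')
    (id : ∀ x, R x x (𝟙 _) (𝟙 _))
    (comp : ∀ x y z φ ψ φ' ψ', R x y φ ψ → R y z φ' ψ' → R x z (φ ≫ φ') (ψ ≫ ψ')) :
    ∃ (T : D ⥤ D) (τ : ∀ x, T.obj (p x) ≅ c x), ∀ x y φ ψ, R x y φ ψ →
      T.map φ ≫ (τ y).hom = (τ x).hom ≫ ψ := by
  choose m hm using hp
  let e (X : D) : p (m X) ≅ X := (hm X).some
  choose r hr using exists_rel
  have r_eq {x y φ ψ} (h : R x y φ ψ) : r x y φ = ψ := unique _ _ _ _ _ (hr _ _ _) h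
  have r_id (x) : r x x (𝟙 _) = 𝟙 _ := r_eq (id x)
  have r_comp (x y z φ φ') : r x y φ ≫ r y z φ' = r x z (φ ≫ φ') :=
    (r_eq (comp _ _ _ _ _ _ _ (hr _ _ _) (hr _ _ _))).symm
  let T : D ⥤ D :=
    { obj := fun X => c (m X)
      map := fun {X Y} f => r (m X) (m Y) ((e X).hom ≫ f ≫ (e Y).inv)
      map_id := fun X => by rw [Category.id_comp, Iso.hom_inv_id, r_id]
      map_comp := fun f g => by simp [r_comp] }
  refine ⟨T, fun x => ⟨r (m (p x)) x (e (p x)).hom, r x (m (p x)) (e (p x)).inv, ?_, ?_⟩, ?_⟩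
  · rw [r_comp, Iso.hom_inv_id, r_id]
  · rw [r_comp, Iso.inv_hom_id, r_id]
  · intro x y φ ψ h
    rw [← r_eq h]
    change r _ _ _ ≫ r _ _ _ = r _ _ _ ≫ r _ _ _
    simp [r_comp]

/-- A family of isomorphisms between the values of two functors at the objects `p x`, natural with
respect to all morphisms, extends to a natural isomorphism if `p` meets all isomorphism classes. -/
lemma nonempty_natIso_of_models {E : Type*} [Category* E] (S S' : D ⥤ E)
    (τ : ∀ x, S.obj (p x) ≅ S'.obj (p x))
    (hτ : ∀ x y (φ : p x ⟶ p y), S.map φ ≫ (τ y).hom = (τ x).hom ≫ S'.map φ) :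
    Nonempty (S ≅ S') := by
  choose m hm using hp
  let e (X : D) : p (m X) ≅ X := (hm X).some
  refine ⟨NatIso.ofComponents
    (fun X => S.mapIso (e X).symm ≪≫ τ (m X) ≪≫ S'.mapIso (e X)) fun {X Y} f => ?_⟩
  have h := hτ _ _ ((e X).hom ≫ f ≫ (e Y).inv)
  have h2 : S.map f ≫ S.map (e Y).inv = S.map (e X).inv ≫ S.map ((e X).hom ≫ f ≫ (e Y).inv) := by
    rw [← Functor.map_comp, ← Functor.map_comp, Iso.inv_hom_id_assoc]
  simp only [Iso.trans_hom, Functor.mapIso_hom, Iso.symm_hom, Category.assoc]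
  rw [reassoc_of% h2, reassoc_of% h, ← Functor.map_comp, ← Functor.map_comp]
  simp

end Models

section Bases

variable {k : Type t} [Field k] {A : Type u} [Category.{v} A] [Abelian A] [Linear k A]
  [HasDerivedCategory.{w} A]

lemma finite_sigma_fin {d : ℤ → ℕ} {b : ℤ} (h : ∀ n, n < -b ∨ b < n → d n = 0) :
    Finite (Σ n, Fin (d n)) := by
  refine Finite.of_injective (β := Σ n : Set.Icc (-b) b, Fin (d n))
    (fun x => ⟨⟨x.1, ?_⟩, x.2⟩) ?_
  · by_contra hx
    have := h x.1 (by rw [Set.mem_Icc] at hx; omega)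
    exact (this ▸ x.2).elim0
  · rintro ⟨n, i⟩ ⟨m, j⟩ hij
    simp only [Sigma.mk.injEq, Subtype.mk.injEq] at hij ⊢
    exact hij

/-- Total finiteness allows the evaluation to be defined on a finite biproduct; as `G` is K-injective,
basis elements are represented by morphisms of complexes. -/
lemma nonempty_evalBasis (F G : CochainComplex A ℤ) [G.IsKInjective] (b : ℤ)
    (hfin : ∀ n : ℤ, Module.Finite k (Q.obj (F⟦n⟧) ⟶ Q.obj G))
    (hzero : ∀ n : ℤ, n < -b ∨ b < n → ∀ x : Q.obj (F⟦n⟧) ⟶ Q.obj G, x = 0) :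
    Nonempty (EvalBasis k F G) := by
  choose e he using fun (n : ℤ)
    (i : Fin (Module.finrank k (Q.obj (F⟦n⟧) ⟶ Q.obj G))) =>
      exists_Q_map_eq (Module.finBasis k _ i)
  refine ⟨⟨fun n => Fin (Module.finrank k (Q.obj (F⟦n⟧) ⟶ Q.obj G)), fun n => inferInstance,
    finite_sigma_fin (b := b) fun n hn => ?_, e, fun n => ?_, fun n => ?_⟩⟩
  · have : Subsingleton (Q.obj (F⟦n⟧) ⟶ Q.obj G) := subsingleton_of_forall_eq 0 (hzero n hn)
    exact Module.finrank_zero_of_subsingleton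
  · simp only [he]
    exact (Module.finBasis k _).linearIndependent
  · simp only [he]
    exact (Module.finBasis k _).span_eq

/-- The analogue of `nonempty_evalBasis` for morphisms to the shifts of a K-injective complex. -/
lemma nonempty_coevBasis (F G : CochainComplex A ℤ) [F.IsKInjective] (b : ℤ)
    (hfin : ∀ n : ℤ, Module.Finite k (Q.obj G ⟶ Q.obj (F⟦n⟧)))
    (hzero : ∀ n : ℤ, n < -b ∨ b < n → ∀ x : Q.obj G ⟶ Q.obj (F⟦n⟧), x = 0) :
    Nonempty (CoevBasis k F G) := by
  choose e he using fun (n : ℤ)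
    (i : Fin (Module.finrank k (Q.obj G ⟶ Q.obj (F⟦n⟧)))) =>
      exists_Q_map_eq (Module.finBasis k _ i)
  refine ⟨⟨fun n => Fin (Module.finrank k (Q.obj G ⟶ Q.obj (F⟦n⟧))), fun n => inferInstance,
    finite_sigma_fin (b := b) fun n hn => ?_, e, fun n => ?_, fun n => ?_⟩⟩
  · have : Subsingleton (Q.obj G ⟶ Q.obj (F⟦n⟧)) := subsingleton_of_forall_eq 0 (hzero n hn)
    exact Module.finrank_zero_of_subsingleton
  · simp only [he]
    exact (Module.finBasis k _).linearIndependent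
  · simp only [he]
    exact (Module.finBasis k _).span_eq

end Bases

section Existence

variable (k : Type t) [Field k] {A : Type u} [Category.{v} A] [Abelian A] [Linear k A]
  [HasDerivedCategory.{w} A] (P : ObjectProperty (DerivedCategory A)) (I : CochainComplex A ℤ)

/-- An object of `P` represented by a K-injective complex `G`, with a basis of `RHom(I, G)`. -/
structure EvalModel where
  G : CochainComplex A ℤ
  isKInjective : G.IsKInjective
  prop : P (Q.obj G)
  basis : EvalBasis k I G

/-- An object of `P` represented by a K-injective complex `G`, with a basis of `RHom(G, I)`. -/
structure CoevModel where
  G : CochainComplex A ℤ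
  isKInjective : G.IsKInjective
  prop : P (Q.obj G)
  basis : CoevBasis k I G

attribute [instance] EvalModel.isKInjective CoevModel.isKInjective

variable {k P I}

/-- The object of the derived category that is represented by a model. -/
def EvalModel.obj (x : EvalModel k P I) : P.FullSubcategory := ⟨Q.obj x.G, x.prop⟩

/-- The object of the derived category that is represented by a model. -/
def CoevModel.obj (x : CoevModel k P I) : P.FullSubcategory := ⟨Q.obj x.G, x.prop⟩

variable {F : DerivedCategory A} {N : ℤ}

/-- A complex representing `F`, shifted by `n`, represents `F⟦n⟧`. -/
def QShiftIso (e : Q.obj I ≅ F) (n : ℤ) : Q.obj (I⟦n⟧) ≅ F⟦n⟧ :=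
  (Q.commShiftIso n).app I ≪≫ (CategoryTheory.shiftFunctor _ n).mapIso e

lemma exists_evalModel [EnoughInjectives A] (e : Q.obj I ≅ F)
    (hP : P ≤ TStructure.t.bounded) [P.IsClosedUnderIsomorphisms] (hF : P F)
    (hsph : IsSpherical k N F) (hdual : HasDuality k P N F) (X : P.FullSubcategory) :
    ∃ x : EvalModel k P I, Nonempty (x.obj ≅ X) := by
  obtain ⟨G, hG, ⟨s⟩⟩ := exists_isKInjective_iso (hP _ X.property)
  have hGP : P (Q.obj G) := P.prop_of_iso s.symm X.property
  obtain ⟨b, hb1, hb2⟩ := exists_vanishing_bound (QShiftIso e) (hP _ hF) (hP _ hGP)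
  obtain ⟨B⟩ := nonempty_evalBasis (k := k) I G (|b| + |N|)
    (fun n => finite_hom_left (QShiftIso e) hdual n hGP) (by
      rintro n (hn | hn) x
      · refine (isSphericalFamily (QShiftIso e) hsph hdual).eq_zero_left n _ rfl _ hGP x fun w => ?_
        rw [hb2 (n + N) (by grind) w, comp_zero]
      · exact hb1 n (by grind) x)
  exact ⟨⟨G, hG, hGP, B⟩, ⟨P.isoMk s⟩⟩

lemma exists_coevModel [EnoughInjectives A] [I.IsKInjective] (e : Q.obj I ≅ F)
    (hP : P ≤ TStructure.t.bounded) [P.IsClosedUnderIsomorphisms] (hF : P F)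
    (hsph : IsSpherical k N F) (hdual : HasDuality k P N F) (X : P.FullSubcategory) :
    ∃ x : CoevModel k P I, Nonempty (x.obj ≅ X) := by
  obtain ⟨G, hG, ⟨s⟩⟩ := exists_isKInjective_iso (hP _ X.property)
  have hGP : P (Q.obj G) := P.prop_of_iso s.symm X.property
  obtain ⟨b, hb1, hb2⟩ := exists_vanishing_bound (QShiftIso e) (hP _ hF) (hP _ hGP)
  obtain ⟨B⟩ := nonempty_coevBasis (k := k) I G (|b| + |N|)
    (fun n => finite_hom_right (QShiftIso e) hdual n hGP) (by
      rintro n (hn | hn) x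
      · exact hb2 n (by grind) x
      · refine (isSphericalFamily (QShiftIso e) hsph hdual).eq_zero_right (n - N) n (by omega) _ hGP x
          fun w => ?_
        rw [hb1 (n - N) (by grind) w, zero_comp])
  exact ⟨⟨G, hG, hGP, B⟩, ⟨P.isoMk s⟩⟩

variable [P.IsTriangulated] [P.IsClosedUnderIsomorphisms]

lemma prop_cone {G : CochainComplex A ℤ} (hI : P (Q.obj I)) (hG : P (Q.obj G))
    (B : EvalBasis k I G) : P (Q.obj B.cone) :=
  prop_Q_mappingCone P _ (prop_Q_biproduct P _ fun _ => prop_Q_shift P hI _) hG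

lemma prop_cocone {G : CochainComplex A ℤ} (hI : P (Q.obj I)) (hG : P (Q.obj G))
    (B : CoevBasis k I G) : P (Q.obj B.cocone) :=
  prop_Q_shift P (prop_Q_mappingCone P _ hG (prop_Q_biproduct P _ fun _ => prop_Q_shift P hI _)) _

lemma exists_twistData (hI : P (Q.obj I))
    (hp : ∀ X, ∃ x : EvalModel k P I, Nonempty (x.obj ≅ X)) :
    ∃ T, Nonempty (TwistData k P I T) := by
  obtain ⟨T, τ, hτ⟩ := exists_functor_of_relation EvalModel.obj hp
    (fun x => ⟨Q.obj x.basis.cone, prop_cone hI x.prop x.basis⟩)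
    (fun x y φ ψ => EvalBasis.IsTwistMap x.basis y.basis φ.hom ψ.hom)
    (fun x y φ => by
      obtain ⟨ψ, h⟩ := EvalBasis.exists_isTwistMap (B := x.basis) (B' := y.basis) φ.hom
      exact ⟨P.homMk ψ, h⟩)
    (fun x y φ ψ ψ' h h' => by
      ext
      exact h.unique h')
    (fun x => .id _)
    (fun x y z φ ψ φ' ψ' h h' => h.comp h')
  refine ⟨T, ⟨⟨fun G _ hG B => P.ι.mapIso (τ ⟨G, ‹_›, hG, B⟩), ?_⟩⟩⟩
  intro G G' _ _ hG hG' B B' f a H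
  exact congrArg P.ι.map (hτ ⟨G, ‹_›, hG, B⟩ ⟨G', ‹_›, hG', B'⟩ (P.homMk (Q.map f))
    (P.homMk (Q.map (mappingCone.mapOfHomotopy H))) (EvalBasis.isTwistMap_mapOfHomotopy H))

lemma exists_dualTwistData [I.IsKInjective] (hI : P (Q.obj I))
    (hp : ∀ X, ∃ x : CoevModel k P I, Nonempty (x.obj ≅ X)) :
    ∃ T, Nonempty (DualTwistData k P I T) := by
  obtain ⟨T, τ, hτ⟩ := exists_functor_of_relation CoevModel.obj hp
    (fun x => ⟨Q.obj x.basis.cocone, prop_cocone hI x.prop x.basis⟩)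
    (fun x y φ ψ => CoevBasis.IsTwistMap x.basis y.basis φ.hom ψ.hom)
    (fun x y φ => by
      obtain ⟨ψ, h⟩ := CoevBasis.exists_isTwistMap (B := x.basis) (B' := y.basis) φ.hom
      exact ⟨P.homMk ψ, h⟩)
    (fun x y φ ψ ψ' h h' => by
      ext
      exact h.unique h')
    (fun x => .id _)
    (fun x y z φ ψ φ' ψ' h h' => h.comp h')
  refine ⟨T, ⟨⟨fun G _ hG B => P.ι.mapIso (τ ⟨G, ‹_›, hG, B⟩), ?_⟩⟩⟩
  intro G G' _ _ hG hG' B B' f a H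
  exact congrArg P.ι.map (hτ ⟨G, ‹_›, hG, B⟩ ⟨G', ‹_›, hG', B'⟩ (P.homMk (Q.map f))
    (P.homMk (Q.map ((mappingCone.mapOfHomotopy H)⟦(-1 : ℤ)⟧')))
    (CoevBasis.isTwistMap_mapOfHomotopy H))

end Existence

end

end SphericalTwist

/-! ### Iterated mapping cones -/

namespace SphericalTwist

noncomputable section

open Pretriangulated CochainComplex DerivedCategory

section Cones

variable {A : Type u} [Category.{v} A] [Abelian A]

/-- The morphism `mappingCone φ ⟶ M` that vanishes on `K⟦1⟧` and is `g` on `L`, where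
`φ : K ⟶ L` and `g : L ⟶ M` have composition zero. -/
def coneDesc {K L M : CochainComplex A ℤ} (φ : K ⟶ L) (g : L ⟶ M) (h : φ ≫ g = 0) :
    mappingCone φ ⟶ M :=
  mappingCone.desc φ 0 g (by simp [h])

@[simp]
lemma inr_coneDesc {K L M : CochainComplex A ℤ} (φ : K ⟶ L) (g : L ⟶ M) (h : φ ≫ g = 0) :
    mappingCone.inr φ ≫ coneDesc φ g h = g :=
  mappingCone.inr_desc φ _ _ _

lemma map_coneDesc {K₁ L₁ K₂ L₂ M₁ M₂ : CochainComplex A ℤ} {φ₁ : K₁ ⟶ L₁} {φ₂ : K₂ ⟶ L₂}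
    {a : K₁ ⟶ K₂} {b : L₁ ⟶ L₂} (comm : φ₁ ≫ b = a ≫ φ₂) {g₁ : L₁ ⟶ M₁} {g₂ : L₂ ⟶ M₂}
    (h₁ : φ₁ ≫ g₁ = 0) (h₂ : φ₂ ≫ g₂ = 0) {c : M₁ ⟶ M₂} (hc : b ≫ g₂ = g₁ ≫ c) :
    mappingCone.map φ₁ φ₂ a b comm ≫ coneDesc φ₂ g₂ h₂ = coneDesc φ₁ g₁ h₁ ≫ c := by
  ext n
  have hn := HomologicalComplex.congr_hom hc n
  simp only [HomologicalComplex.comp_f] at hn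
  simp [mappingCone.ext_from_iff _ (n + 1) n rfl, mappingCone.map, coneDesc, hn]

lemma shortExact_cone {K L : CochainComplex A ℤ} (φ : K ⟶ L) :
    (ShortComplex.mk (mappingCone.inr φ) (coneδ φ) (inr_coneδ φ)).ShortExact where
  exact := ShortComplex.exact_of_f_is_kernel _
    (KernelFork.IsLimit.ofι' _ (inr_coneδ φ) fun d hd =>
      ⟨(exists_eq_comp_inr φ d hd).choose, (exists_eq_comp_inr φ d hd).choose_spec.symm⟩)
  mono_f := mono_inr φ
  epi_g := epi_coneδ φ

lemma shortExact_shift_cone {K L : CochainComplex A ℤ} (φ : K ⟶ L) (n : ℤ) :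
    (ShortComplex.mk ((mappingCone.inr φ)⟦n⟧') ((coneδ φ)⟦n⟧')
      (by rw [← Functor.map_comp, inr_coneδ, Functor.map_zero])).ShortExact := by
  have h := (shortExact_cone φ).map_of_exact (CategoryTheory.shiftFunctor (CochainComplex A ℤ) n)
  exact h

/-- `(G⟦1⟧)⟦-1⟧ ≅ G`. -/
def shiftCancel (G : CochainComplex A ℤ) : G⟦(1 : ℤ)⟧⟦(-1 : ℤ)⟧ ≅ G :=
  (shiftFunctorCompIsoId (CochainComplex A ℤ) (1 : ℤ) (-1 : ℤ) (add_neg_cancel 1)).app G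

lemma shiftCancel_naturality {G G' : CochainComplex A ℤ} (f : G ⟶ G') :
    f⟦(1 : ℤ)⟧'⟦(-1 : ℤ)⟧' ≫ (shiftCancel G').hom = (shiftCancel G).hom ≫ f :=
  (shiftFunctorCompIsoId (CochainComplex A ℤ) (1 : ℤ) (-1 : ℤ) (add_neg_cancel 1)).hom.naturality f

variable [HasDerivedCategory.{w} A]

lemma isIso_Q_coneDesc {K L M : CochainComplex A ℤ} {φ : K ⟶ L} {g : L ⟶ M} (h : φ ≫ g = 0)
    (hS : (ShortComplex.mk φ g h).ShortExact) : IsIso (Q.map (coneDesc φ g h)) := by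
  have h1 : coneDesc φ g h = mappingCone.descShortComplex (ShortComplex.mk φ g h) := rfl
  have h2 := mappingCone.quasiIso_descShortComplex hS
  rw [h1]
  infer_instance

lemma isIso_Q_map {K₁ L₁ K₂ L₂ : CochainComplex A ℤ} {φ₁ : K₁ ⟶ L₁} {φ₂ : K₂ ⟶ L₂}
    {a : K₁ ⟶ K₂} {b : L₁ ⟶ L₂} (comm : φ₁ ≫ b = a ≫ φ₂) (ha : IsIso (Q.map a))
    (hb : IsIso (Q.map b)) : IsIso (Q.map (mappingCone.map φ₁ φ₂ a b comm)) :=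
  isIso₃_of_isIso₁₂ (Q.mapTriangle.map (mappingCone.triangleMap φ₁ φ₂ a b comm))
    (mappingCone_triangle_distinguished φ₁) (mappingCone_triangle_distinguished φ₂) ha hb

lemma isIso_Q_map_shift {K L : CochainComplex A ℤ} {f : K ⟶ L} (hf : IsIso (Q.map f)) (n : ℤ) :
    IsIso (Q.map (f⟦n⟧')) :=
  (NatIso.isIso_map_iff (Q.commShiftIso n) f).2
    (inferInstanceAs (IsIso ((CategoryTheory.shiftFunctor _ n).map (Q.map f))))

section Rotation

variable {K G S : CochainComplex A ℤ} (φ : K ⟶ G) {w : K⟦(1 : ℤ)⟧ ⟶ S} {c : mappingCone φ ⟶ S}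
  (hc : c = coneδ φ ≫ w)

include hc in
omit [HasDerivedCategory.{w} A] in
lemma inr_comp_of_eq_coneδ_comp : mappingCone.inr φ ≫ c = 0 := by
  rw [hc, ← Category.assoc, inr_coneδ, zero_comp]

/-- The morphism from the cone of `mappingCone φ ⟶ mappingCone (inr φ)` to the cone of
a composition `mappingCone φ ⟶ K⟦1⟧ ⟶ S`. -/
def rotationRight :
    mappingCone (mappingCone.inr (mappingCone.inr φ)) ⟶ mappingCone c :=
  mappingCone.map _ _ (𝟙 _) (coneDesc (mappingCone.inr φ) c (inr_comp_of_eq_coneδ_comp φ hc))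
    (by rw [inr_coneDesc, Category.id_comp])

/-- The morphism from the cone of `mappingCone φ ⟶ mappingCone (inr φ)` to `G⟦1⟧`. -/
def rotationLeft : mappingCone (mappingCone.inr (mappingCone.inr φ)) ⟶ G⟦(1 : ℤ)⟧ :=
  coneDesc _ (coneδ (mappingCone.inr φ)) (inr_coneδ _)

lemma isIso_Q_rotationLeft : IsIso (Q.map (rotationLeft φ)) :=
  isIso_Q_coneDesc _ (shortExact_cone _)

lemma isIso_Q_rotationRight (hw : IsIso (Q.map w)) : IsIso (Q.map (rotationRight φ hc)) := by
  refine isIso_Q_map _ (by rw [CategoryTheory.Functor.map_id]; infer_instance) ?_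
  have h1 := isIso_Q_coneDesc (inr_coneδ φ) (shortExact_cone φ)
  have h2 : coneDesc (mappingCone.inr φ) c (inr_comp_of_eq_coneδ_comp φ hc) =
      coneDesc (mappingCone.inr φ) (coneδ φ) (inr_coneδ φ) ≫ w := by
    have h3 := map_coneDesc (φ₁ := mappingCone.inr φ) (φ₂ := mappingCone.inr φ) (a := 𝟙 _)
      (b := 𝟙 _) (by simp) (inr_coneδ φ) (inr_comp_of_eq_coneδ_comp φ hc) (c := w) (by simp [hc])
    rwa [mappingCone.map_id, Category.id_comp] at h3
  rw [h2, Functor.map_comp]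
  infer_instance

/-- The rotation of a standard triangle: the shifted cone of `mappingCone φ ⟶ K⟦1⟧ ≅ S` is
isomorphic to the target of `φ`. -/
def rotationIso (hw : IsIso (Q.map w)) : Q.obj ((mappingCone c)⟦(-1 : ℤ)⟧) ≅ Q.obj G :=
  have := isIso_Q_map_shift (isIso_Q_rotationRight φ hc hw) (-1)
  have := isIso_Q_map_shift (isIso_Q_rotationLeft φ) (-1)
  (asIso (Q.map ((rotationRight φ hc)⟦(-1 : ℤ)⟧'))).symm ≪≫
    asIso (Q.map ((rotationLeft φ)⟦(-1 : ℤ)⟧')) ≪≫ Q.mapIso (shiftCancel G)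

variable {K' G' S' : CochainComplex A ℤ} {φ : K ⟶ G} {φ' : K' ⟶ G'} {w : K⟦(1 : ℤ)⟧ ⟶ S}
  {w' : K'⟦(1 : ℤ)⟧ ⟶ S'} {c : mappingCone φ ⟶ S} {c' : mappingCone φ' ⟶ S'}

omit [HasDerivedCategory.{w} A] in
lemma IsConeMap.comp_eq {a : K ⟶ K'} {f : G ⟶ G'} {m : mappingCone φ ⟶ mappingCone φ'}
    (hm : IsConeMap φ φ' a f m) (hc : c = coneδ φ ≫ w) (hc' : c' = coneδ φ' ≫ w') {s : S ⟶ S'}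
    (hs : w ≫ s = a⟦(1 : ℤ)⟧' ≫ w') : c ≫ s = m ≫ c' := by
  rw [hc, hc', Category.assoc, hs, ← Category.assoc, ← hm.comp_coneδ, Category.assoc]

/-- The rotation is natural in morphisms of cones that strictly commute with the structural
morphisms; no homotopy has to be compared. -/
lemma rotationIso_naturality (hc : c = coneδ φ ≫ w) (hc' : c' = coneδ φ' ≫ w')
    (hw : IsIso (Q.map w)) (hw' : IsIso (Q.map w')) {a : K ⟶ K'}
    {f : G ⟶ G'} {m : mappingCone φ ⟶ mappingCone φ'} (hm : IsConeMap φ φ' a f m) {s : S ⟶ S'}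
    (comm : c ≫ s = m ≫ c') :
    Q.map ((mappingCone.mapOfHomotopy (Homotopy.ofEq comm))⟦(-1 : ℤ)⟧') ≫
        (rotationIso φ' hc' hw').hom =
      (rotationIso φ hc hw).hom ≫ Q.map f := by
  rw [← mappingCone.map_eq_mapOfHomotopy]
  let m₂ := mappingCone.map _ _ f m hm.inr_comp
  have hm₂ : IsConeMap _ _ f m m₂ := by
    dsimp only [m₂]
    rw [mappingCone.map_eq_mapOfHomotopy]
    exact .mapOfHomotopy _
  let m₃ := mappingCone.map _ _ m m₂ hm₂.inr_comp
  have h1 : m₃ ≫ rotationLeft φ' = rotationLeft φ ≫ f⟦(1 : ℤ)⟧' :=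
    map_coneDesc _ _ _ hm₂.comp_coneδ
  have h2 : m₃ ≫ rotationRight φ' hc' = rotationRight φ hc ≫ mappingCone.map _ _ m s comm := by
    have h3 : m₂ ≫ coneDesc _ _ (inr_comp_of_eq_coneδ_comp φ' hc') =
        coneDesc _ _ (inr_comp_of_eq_coneδ_comp φ hc) ≫ s := map_coneDesc _ _ _ comm.symm
    dsimp only [m₃, rotationRight]
    rw [← mappingCone.map_comp, ← mappingCone.map_comp]
    congr 1
    simp
  have h4 := isIso_Q_map_shift (isIso_Q_rotationRight φ hc hw) (-1)
  rw [← cancel_epi (Q.map ((rotationRight φ hc)⟦(-1 : ℤ)⟧'))]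
  simp only [rotationIso, Iso.trans_hom, Iso.symm_hom, asIso_hom, asIso_inv, Category.assoc,
    IsIso.hom_inv_id_assoc, Functor.mapIso_hom]
  rw [← Functor.map_comp_assoc, ← Functor.map_comp, ← h2, Functor.map_comp, Functor.map_comp,
    Category.assoc, IsIso.hom_inv_id_assoc, ← Functor.map_comp_assoc, ← Functor.map_comp _ m₃, h1,
    Functor.map_comp, Functor.map_comp, Category.assoc, ← Functor.map_comp,
    shiftCancel_naturality, Functor.map_comp]

end Rotation

section InverseRotation

variable {G K S : CochainComplex A ℤ} (φ : G ⟶ K) {w : S ⟶ K⟦(-1 : ℤ)⟧}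
  {c : S ⟶ (mappingCone φ)⟦(-1 : ℤ)⟧} (hc : c = w ≫ (mappingCone.inr φ)⟦(-1 : ℤ)⟧')

include hc in
omit [HasDerivedCategory.{w} A] in
lemma comp_coneδ_of_eq_comp_inr : c ≫ (coneδ φ)⟦(-1 : ℤ)⟧' = 0 := by
  rw [hc, Category.assoc, ← Functor.map_comp, inr_coneδ, Functor.map_zero, comp_zero]

/-- The morphism from the cone of a composition `S ⟶ K⟦-1⟧ ⟶ (mappingCone φ)⟦-1⟧` to
`(G⟦1⟧)⟦-1⟧`. -/
def invRotation : mappingCone c ⟶ G⟦(1 : ℤ)⟧⟦(-1 : ℤ)⟧ :=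
  coneDesc _ _ (comp_coneδ_of_eq_comp_inr φ hc)

lemma isIso_Q_invRotation (hw : IsIso (Q.map w)) : IsIso (Q.map (invRotation φ hc)) := by
  have h0 := shortExact_shift_cone φ (-1)
  have h1 := isIso_Q_coneDesc _ h0
  have h2 : IsIso (Q.map (mappingCone.map c
      ((mappingCone.inr φ)⟦(-1 : ℤ)⟧') w (𝟙 _) (by rw [Category.comp_id, hc]))) :=
    isIso_Q_map _ hw (by rw [CategoryTheory.Functor.map_id]; infer_instance)
  have h3 := map_coneDesc (φ₁ := c)
    (φ₂ := (mappingCone.inr φ)⟦(-1 : ℤ)⟧') (a := w) (b := 𝟙 _) (by rw [Category.comp_id, hc])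
    (comp_coneδ_of_eq_comp_inr φ hc) (by rw [← Functor.map_comp, inr_coneδ, Functor.map_zero])
    (c := 𝟙 _) (by simp)
  have h4 : invRotation φ hc = _ := (Category.comp_id _).symm.trans h3.symm
  rw [h4, Functor.map_comp]
  infer_instance

/-- The inverse rotation of a standard triangle: the cone of
`S ≅ K⟦-1⟧ ⟶ (mappingCone φ)⟦-1⟧` is isomorphic to the source of `φ`. -/
def invRotationIso (hw : IsIso (Q.map w)) : Q.obj (mappingCone c) ≅ Q.obj G :=
  have := isIso_Q_invRotation φ hc hw
  asIso (Q.map (invRotation φ hc)) ≪≫ Q.mapIso (shiftCancel G)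

variable {G' K' S' : CochainComplex A ℤ} {φ : G ⟶ K} {φ' : G' ⟶ K'} {w : S ⟶ K⟦(-1 : ℤ)⟧}
  {w' : S' ⟶ K'⟦(-1 : ℤ)⟧} {c : S ⟶ (mappingCone φ)⟦(-1 : ℤ)⟧}
  {c' : S' ⟶ (mappingCone φ')⟦(-1 : ℤ)⟧}

omit [HasDerivedCategory.{w} A] in
lemma IsConeMap.shift_comp_eq {f : G ⟶ G'} {b : K ⟶ K'} {m : mappingCone φ ⟶ mappingCone φ'}
    (hm : IsConeMap φ φ' f b m) (hc : c = w ≫ (mappingCone.inr φ)⟦(-1 : ℤ)⟧')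
    (hc' : c' = w' ≫ (mappingCone.inr φ')⟦(-1 : ℤ)⟧') {s : S ⟶ S'}
    (hs : s ≫ w' = w ≫ b⟦(-1 : ℤ)⟧') : c ≫ m⟦(-1 : ℤ)⟧' = s ≫ c' := by
  rw [hc, hc', Category.assoc, ← Functor.map_comp, hm.inr_comp, Functor.map_comp,
    ← Category.assoc, ← hs, Category.assoc]

/-- The inverse rotation is natural in the same strict sense as in `rotationIso_naturality`. -/
lemma invRotationIso_naturality (hc : c = w ≫ (mappingCone.inr φ)⟦(-1 : ℤ)⟧')
    (hc' : c' = w' ≫ (mappingCone.inr φ')⟦(-1 : ℤ)⟧') (hw : IsIso (Q.map w))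
    (hw' : IsIso (Q.map w')) {f : G ⟶ G'} {b : K ⟶ K'} {m : mappingCone φ ⟶ mappingCone φ'}
    (hm : IsConeMap φ φ' f b m) {s : S ⟶ S'} (comm : c ≫ m⟦(-1 : ℤ)⟧' = s ≫ c') :
    Q.map (mappingCone.mapOfHomotopy (Homotopy.ofEq comm)) ≫ (invRotationIso φ' hc' hw').hom =
      (invRotationIso φ hc hw).hom ≫ Q.map f := by
  rw [← mappingCone.map_eq_mapOfHomotopy]
  have h1 : mappingCone.map _ _ s (m⟦(-1 : ℤ)⟧') comm ≫ invRotation φ' hc' =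
      invRotation φ hc ≫ f⟦(1 : ℤ)⟧'⟦(-1 : ℤ)⟧' :=
    map_coneDesc _ _ _ (by rw [← Functor.map_comp, hm.comp_coneδ, Functor.map_comp])
  simp only [invRotationIso, Iso.trans_hom, asIso_hom, Functor.mapIso_hom]
  rw [← Functor.map_comp_assoc, h1, Functor.map_comp, Category.assoc, Category.assoc,
    ← Functor.map_comp, shiftCancel_naturality, Functor.map_comp]

end InverseRotation

end Cones

end

end SphericalTwist

/-! ### Bases for the twisted objects -/

namespace SphericalTwist

noncomputable section

open Pretriangulated CochainComplex DerivedCategory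

variable {k : Type t} [Field k] {A : Type u} [Category.{v} A] [Abelian A] [Linear k A]
  [HasDerivedCategory.{w} A]

section Sums

variable {J J' : Type} [Fintype J] [Fintype J'] (X : J → CochainComplex A ℤ)
  (Y : J' → CochainComplex A ℤ) [HasBiproduct X] [HasBiproduct Y] (ε : J' ≃ J) (n : ℤ)
  (r : ∀ j, Y j ⟶ (X (ε j))⟦n⟧)

/-- A morphism `⨁ Y ⟶ (⨁ X)⟦n⟧` that matches the summands by quasi-isomorphisms is itself a
quasi-isomorphism. -/
lemma isIso_Q_of_ι_comp (hr : ∀ j, IsIso (Q.map (r j))) (z : ⨁ Y ⟶ (⨁ X)⟦n⟧)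
    (hz : ∀ j, biproduct.ι Y j ≫ z = r j ≫ (biproduct.ι X (ε j))⟦n⟧') : IsIso (Q.map z) := by
  classical
  refine ⟨∑ j, Q.map ((biproduct.π X (ε j))⟦n⟧') ≫ inv (Q.map (r j)) ≫ Q.map (biproduct.ι Y j),
    ?_, ?_⟩
  · refine Q_biproduct_hom_ext_from _ fun j => ?_
    rw [← Category.assoc, ← Functor.map_comp, hz, Preadditive.comp_sum,
      Finset.sum_eq_single j]
    · rw [← Functor.map_comp_assoc, Category.assoc, ← Functor.map_comp, biproduct.ι_π_self,
        CategoryTheory.Functor.map_id, Category.comp_id, IsIso.hom_inv_id_assoc, Category.comp_id]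
    · intro i _ hij
      rw [← Functor.map_comp_assoc, Category.assoc, ← Functor.map_comp,
        biproduct.ι_π_ne _ (fun h => hij (ε.injective h).symm), Functor.map_zero, comp_zero,
        Functor.map_zero, zero_comp]
    · simp
  · rw [Preadditive.sum_comp]
    simp only [Category.assoc, ← Functor.map_comp, hz]
    simp only [Functor.map_comp, IsIso.inv_hom_id_assoc]
    simp only [← Functor.map_comp]
    rw [← Functor.map_sum, ← Functor.map_sum,
      Equiv.sum_comp ε (fun i => biproduct.π X i ≫ biproduct.ι X i), biproduct.total,
      CategoryTheory.Functor.map_id, CategoryTheory.Functor.map_id]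

/-- A morphism `(⨁ X)⟦n⟧ ⟶ ⨁ Y` that matches the summands by quasi-isomorphisms is itself a
quasi-isomorphism. -/
lemma isIso_Q_of_comp_π (s : ∀ j, (X (ε j))⟦n⟧ ⟶ Y j) (hs : ∀ j, IsIso (Q.map (s j)))
    (z : (⨁ X)⟦n⟧ ⟶ ⨁ Y)
    (hz : ∀ j, z ≫ biproduct.π Y j = (biproduct.π X (ε j))⟦n⟧' ≫ s j) : IsIso (Q.map z) := by
  classical
  refine ⟨∑ j, Q.map (biproduct.π Y j) ≫ inv (Q.map (s j)) ≫ Q.map ((biproduct.ι X (ε j))⟦n⟧'),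
    ?_, ?_⟩
  · rw [Preadditive.comp_sum]
    simp only [← Category.assoc, ← Functor.map_comp, hz]
    simp only [Functor.map_comp, Category.assoc, IsIso.hom_inv_id_assoc]
    simp only [← Functor.map_comp]
    rw [← Functor.map_sum, ← Functor.map_sum,
      Equiv.sum_comp ε (fun i => biproduct.π X i ≫ biproduct.ι X i), biproduct.total,
      CategoryTheory.Functor.map_id, CategoryTheory.Functor.map_id]
  · refine Q_biproduct_hom_ext_to _ fun j => ?_
    rw [Category.assoc, ← Functor.map_comp, hz, Preadditive.sum_comp, Finset.sum_eq_single j]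
    · rw [Category.assoc, Category.assoc, ← Functor.map_comp, ← Functor.map_comp_assoc,
        biproduct.ι_π_self, CategoryTheory.Functor.map_id, Category.id_comp,
        IsIso.inv_hom_id, Category.comp_id, Category.id_comp]
    · intro i _ hij
      rw [Category.assoc, Category.assoc, ← Functor.map_comp, ← Functor.map_comp_assoc,
        biproduct.ι_π_ne _ (fun h => hij (ε.injective h)), Functor.map_zero,
        zero_comp, Functor.map_zero, comp_zero, comp_zero]
    · simp

end Sums

/-- The sum of the classes of a finite family of complexes, as a bicone in the derived category. -/
abbrev QBicone {J : Type} (X : J → CochainComplex A ℤ) [HasBiproduct X] :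
    Bicone fun j => Q.obj (X j) :=
  Q.mapBicone (biproduct.bicone X)

/-- The degree shift of the index set of a graded basis. -/
def sigmaShiftEquiv (J : ℤ → Type) (c : ℤ) : (Σ n, J (n + c)) ≃ Σ n, J n :=
  Equiv.sigmaCongrLeft (Equiv.addRight c)

lemma linearIndependent_of_linearEquiv {ι V W : Type*} [AddCommGroup V] [Module k V]
    [AddCommGroup W] [Module k W] {f : ι → V} (hf : LinearIndependent k f) (L : V ≃ₗ[k] W)
    {g : ι → W} (h : ∀ j, g j = L (f j)) : LinearIndependent k g := by
  obtain rfl : g = L ∘ f := funext h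
  exact hf.map' L.toLinearMap L.ker

lemma span_eq_top_of_linearEquiv {ι V W : Type*} [AddCommGroup V] [Module k V]
    [AddCommGroup W] [Module k W] {f : ι → V} (hf : Submodule.span k (Set.range f) = ⊤)
    (L : V ≃ₗ[k] W) {g : ι → W} (h : ∀ j, g j = L (f j)) :
    Submodule.span k (Set.range g) = ⊤ := by
  obtain rfl : g = L ∘ f := funext h
  have h2 := congrArg (Submodule.map L.toLinearMap) hf
  rw [Submodule.map_span, Submodule.map_top, LinearEquiv.range, ← Set.range_comp] at h2
  exact h2

variable {P : ObjectProperty (DerivedCategory A)} {I I' : CochainComplex A ℤ} {N : ℤ}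

namespace EvalBasis

variable {G G' : CochainComplex A ℤ} (B : EvalBasis k I G) (B' : EvalBasis k I G')
  {u : I ⟶ I'}

lemma tensorMap_π (a : ∀ n, B.ι n → B'.ι n → k) (n : ℤ) (j : B'.ι n) :
    B.tensorMap B' a ≫ biproduct.π (fun p : (Σ n, B'.ι n) => I⟦p.1⟧) ⟨n, j⟩ =
      ∑ i, a n i j • biproduct.π (fun p : (Σ n, B.ι n) => I⟦p.1⟧) ⟨n, i⟩ := by
  classical
  refine biproduct.hom_ext' _ _ ?_
  rintro ⟨m, i⟩
  rw [← Category.assoc, ι_tensorMap, Preadditive.sum_comp, Preadditive.comp_sum]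
  simp only [Linear.smul_comp, Linear.comp_smul]
  by_cases h : m = n
  · subst h
    rw [Finset.sum_eq_single j, Finset.sum_eq_single i, biproduct.ι_π_self, biproduct.ι_π_self]
    · intro l _ hl
      rw [biproduct.ι_π_ne _ (by simpa using hl.symm), smul_zero]
    · simp
    · intro l _ hl
      rw [biproduct.ι_π_ne _ (by simpa using hl), smul_zero]
    · simp
  · rw [Finset.sum_eq_zero, Finset.sum_eq_zero]
    · intro l _
      rw [biproduct.ι_π_ne _ (fun h' => h (congrArg Sigma.fst h')), smul_zero]
    · intro l _
      rw [biproduct.ι_π_ne _ (fun h' => h (congrArg Sigma.fst h')), smul_zero]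

variable (u) in
/-- The morphism `(I⟦n - 1⟧)⟦1⟧ ≅ I⟦n⟧ ⟶ I'⟦n⟧` induced by `u : I ⟶ I'`. -/
def shiftComp (n : ℤ) : I⟦n + -1⟧⟦(1 : ℤ)⟧ ⟶ I'⟦n⟧ :=
  (CategoryTheory.shiftFunctorAdd' (CochainComplex A ℤ) (n + -1) 1 n (by omega)).inv.app I ≫
    u⟦n⟧'

lemma isIso_Q_shiftComp (hu : IsIso (Q.map u)) (n : ℤ) : IsIso (Q.map (shiftComp u n)) := by
  have := isIso_Q_map_shift hu n
  rw [shiftComp, Functor.map_comp]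
  infer_instance

section

lemma QBicone_ι_ev (n : ℤ) (j : B.ι n) :
    (QBicone fun p : (Σ n, B.ι n) => I⟦p.1⟧).ι ⟨n, j⟩ ≫ Q.map B.ev = Q.map (B.e n j) := by
  rw [← ι_ev]
  exact (Q.map_comp _ _).symm

variable (hΦ : IsSphericalFamily k P N fun n => Q.obj (I⟦n⟧)) (hN : 1 ≤ N) (hG : P (Q.obj G))
  (hu : IsIso (Q.map u))

variable (k) in
/-- The linear equivalence between `Hom(X, (I⟦n - 1⟧)⟦1⟧)` and `Hom(X, I'⟦n⟧)` that is induced by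
a quasi-isomorphism `I ⟶ I'`. -/
def shiftCompEquiv (n : ℤ) (X : DerivedCategory A) :
    (X ⟶ (Q.obj (I⟦n + -1⟧))⟦(1 : ℤ)⟧) ≃ₗ[k] (X ⟶ Q.obj (I'⟦n⟧)) :=
  have := isIso_Q_shiftComp hu n
  Linear.homCongr k (Iso.refl X)
    ((Q.commShiftIso (1 : ℤ)).symm.app (I⟦n + -1⟧) ≪≫ asIso (Q.map (shiftComp u n)))

variable (u) in
/-- The component `B.cone ⟶ (I ⊗ RHom(I, G))⟦1⟧ ⟶ (I⟦n - 1⟧)⟦1⟧ ≅ I⟦n⟧ ⟶ I'⟦n⟧`. -/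
def coneComponent (n : ℤ) (j : B.ι (n + -1)) : B.cone ⟶ I'⟦n⟧ :=
  coneδ B.ev ≫ (biproduct.π (fun p : (Σ n, B.ι n) => I⟦p.1⟧) ⟨n + -1, j⟩)⟦(1 : ℤ)⟧' ≫
    shiftComp u n

lemma Q_map_coneComponent (n : ℤ) (j : B.ι (n + -1)) :
    Q.map (B.coneComponent u n j) = shiftCompEquiv k hu n _
      ((Q.map (coneδ B.ev) ≫ (Q.commShiftIso (1 : ℤ)).hom.app B.tensor) ≫
        ((QBicone fun p : (Σ n, B.ι n) => I⟦p.1⟧).π ⟨n + -1, j⟩)⟦(1 : ℤ)⟧') := by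
  have h : Q.map ((biproduct.π (fun p : (Σ n, B.ι n) => I⟦p.1⟧) ⟨n + -1, j⟩)⟦(1 : ℤ)⟧') =
      (Q.commShiftIso (1 : ℤ)).hom.app B.tensor ≫
        (Q.map (biproduct.π (fun p : (Σ n, B.ι n) => I⟦p.1⟧) ⟨n + -1, j⟩))⟦(1 : ℤ)⟧' ≫
          (Q.commShiftIso (1 : ℤ)).inv.app (I⟦n + -1⟧) := by
    rw [← Functor.commShiftIso_hom_naturality_assoc, Iso.hom_inv_id_app]
    exact (Category.comp_id _).symm
  simp only [coneComponent, Functor.map_comp, h, shiftCompEquiv, Linear.homCongr_apply,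
    Iso.refl_inv, Iso.trans_hom, asIso_hom, Category.assoc, Category.id_comp]
  rfl

/-- For a spherical `I` and a quasi-isomorphism `u : I ⟶ I'` to a K-injective complex, a basis of
`RHom(I, G)` gives a basis of `RHom(X, I')` for the cone `X` of the evaluation: it consists of the
components of `X ⟶ (I ⊗ RHom(I, G))⟦1⟧`. -/
def coneBasis : CoevBasis k I' B.cone where
  ι n := B.ι (n + -1)
  fintype_ι _ := inferInstance
  finite_sigma := Finite.of_equiv _ (sigmaShiftEquiv B.ι (-1)).symm
  e n j := B.coneComponent u n j
  linearIndependent n :=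
    linearIndependent_of_linearEquiv
      (hΦ.linearIndependent_cone hN (QBicone fun p : (Σ n, B.ι n) => I⟦p.1⟧) hG
        (Q_cone_distinguished B.ev)
        (fun n => span_eq_top_of_linearEquiv (B.span_eq_top n) (.refl k _) (B.QBicone_ι_ev n)) (n + -1))
      (shiftCompEquiv k hu n _) (B.Q_map_coneComponent hu n)
  span_eq_top n :=
    have := Fintype.ofFinite (Σ n, B.ι n)
    span_eq_top_of_linearEquiv
      (hΦ.span_cone (QBicone fun p : (Σ n, B.ι n) => I⟦p.1⟧) hG
        (Q_cone_distinguished B.ev)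
        (fun n => linearIndependent_of_linearEquiv (B.linearIndependent n) (.refl k _)
          (B.QBicone_ι_ev n))
        (fun n => span_eq_top_of_linearEquiv (B.span_eq_top n) (.refl k _) (B.QBicone_ι_ev n))
        (sum_Q_map_π_comp_Q_map_ι _) (n + -1))
      (shiftCompEquiv k hu n _) (B.Q_map_coneComponent hu n)

/-- The isomorphism (in the derived category) from `(I ⊗ RHom(I, G))⟦1⟧` to the target of the
coevaluation of `B.cone`. -/
def shiftTensor : B.tensor⟦(1 : ℤ)⟧ ⟶ (B.coneBasis hΦ hN hG hu).tensor :=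
  biproduct.lift fun p => (biproduct.π (fun p : (Σ n, B.ι n) => I⟦p.1⟧)
    ⟨p.1 + -1, p.2⟩)⟦(1 : ℤ)⟧' ≫ shiftComp u p.1

lemma shiftTensor_π (n : ℤ) (j : (B.coneBasis hΦ hN hG hu).ι n) :
    B.shiftTensor hΦ hN hG hu ≫
      biproduct.π (fun p : (Σ n, (B.coneBasis hΦ hN hG hu).ι n) => I'⟦p.1⟧) ⟨n, j⟩ =
    (biproduct.π (fun p : (Σ n, B.ι n) => I⟦p.1⟧) ⟨n + -1, j⟩)⟦(1 : ℤ)⟧' ≫ shiftComp u n :=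
  biproduct.lift_π _ _

/-- Up to the isomorphism `shiftTensor`, the coevaluation of the cone is the third morphism of the
triangle of the evaluation. -/
lemma coneBasis_coev :
    (B.coneBasis hΦ hN hG hu).coev = coneδ B.ev ≫ B.shiftTensor hΦ hN hG hu := by
  refine biproduct.hom_ext _ _ ?_
  rintro ⟨n, j⟩
  rw [CoevBasis.coev_π, Category.assoc, shiftTensor_π]
  rfl

lemma isIso_Q_shiftTensor : IsIso (Q.map (B.shiftTensor hΦ hN hG hu)) := by
  have := Fintype.ofFinite (Σ n, B.ι n)
  have := Fintype.ofFinite (Σ n, (B.coneBasis hΦ hN hG hu).ι n)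
  exact isIso_Q_of_comp_π (fun p : (Σ n, B.ι n) => I⟦p.1⟧)
    (fun p : (Σ n, (B.coneBasis hΦ hN hG hu).ι n) => I'⟦p.1⟧) (sigmaShiftEquiv B.ι (-1)) 1
    (fun p => shiftComp u p.1) (fun p => isIso_Q_shiftComp hu p.1) _
    (fun p => B.shiftTensor_π hΦ hN hG hu p.1 p.2)

/-- The matrix, in the bases for the cones, of the map that has the matrix `a` in the given
bases: its transpose, with the degrees raised by one. -/
def coneMatrix (hG' : P (Q.obj G')) (a : ∀ n, B.ι n → B'.ι n → k) (n : ℤ)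
    (j : (B'.coneBasis hΦ hN hG' hu).ι n) (i : (B.coneBasis hΦ hN hG hu).ι n) : k :=
  a (n + -1) i j

lemma shiftTensor_tensorMap (hG' : P (Q.obj G')) (a : ∀ n, B.ι n → B'.ι n → k) :
    B.shiftTensor hΦ hN hG hu ≫ (B.coneBasis hΦ hN hG hu).tensorMap (B'.coneBasis hΦ hN hG' hu)
      (B.coneMatrix B' hΦ hN hG hu hG' a) =
    (B.tensorMap B' a)⟦(1 : ℤ)⟧' ≫ B'.shiftTensor hΦ hN hG' hu := by
  refine biproduct.hom_ext _ _ ?_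
  rintro ⟨n, j⟩
  rw [Category.assoc, CoevBasis.tensorMap_π, Category.assoc, shiftTensor_π,
    ← Functor.map_comp_assoc]
  refine Eq.trans ?_ (congrArg (fun x => x⟦(1 : ℤ)⟧' ≫ shiftComp u n)
    (B.tensorMap_π B' a (n + -1) j)).symm
  rw [Preadditive.comp_sum, Functor.map_sum, Preadditive.sum_comp]
  refine Finset.sum_congr rfl fun i _ => ?_
  rw [Linear.comp_smul, Functor.map_smul, Linear.smul_comp]
  exact congrArg _ (B.shiftTensor_π hΦ hN hG hu n i)

end

end EvalBasis

namespace CoevBasis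

variable {G G' : CochainComplex A ℤ} (B : CoevBasis k I' G) (B' : CoevBasis k I' G')
  {u : I ⟶ I'}

lemma ι_tensorMap (a : ∀ n, B'.ι n → B.ι n → k) (n : ℤ) (j : B.ι n) :
    biproduct.ι (fun p : (Σ n, B.ι n) => I'⟦p.1⟧) ⟨n, j⟩ ≫ B.tensorMap B' a =
      ∑ i, a n i j • biproduct.ι (fun p : (Σ n, B'.ι n) => I'⟦p.1⟧) ⟨n, i⟩ := by
  classical
  refine biproduct.hom_ext _ _ ?_
  rintro ⟨m, i⟩
  rw [Category.assoc, tensorMap_π, Preadditive.sum_comp, Preadditive.comp_sum]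
  simp only [Linear.smul_comp, Linear.comp_smul]
  by_cases h : m = n
  · subst h
    rw [Finset.sum_eq_single j, Finset.sum_eq_single i, biproduct.ι_π_self, biproduct.ι_π_self]
    · intro l _ hl
      rw [biproduct.ι_π_ne _ (by simpa using hl), smul_zero]
    · simp
    · intro l _ hl
      rw [biproduct.ι_π_ne _ (by simpa using hl.symm), smul_zero]
    · simp
  · rw [Finset.sum_eq_zero, Finset.sum_eq_zero]
    · intro l _
      rw [biproduct.ι_π_ne _ (fun h' => h (congrArg Sigma.fst h').symm), smul_zero]
    · intro l _
      rw [biproduct.ι_π_ne _ (fun h' => h (congrArg Sigma.fst h').symm), smul_zero]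

variable (u) in
/-- The morphism `I⟦n⟧ ⟶ I'⟦n⟧ ≅ (I'⟦n + 1⟧)⟦-1⟧` induced by `u : I ⟶ I'`. -/
def compShift (n : ℤ) : I⟦n⟧ ⟶ I'⟦n + 1⟧⟦(-1 : ℤ)⟧ :=
  u⟦n⟧' ≫
    (CategoryTheory.shiftFunctorAdd' (CochainComplex A ℤ) (n + 1) (-1) n (by omega)).hom.app I'

lemma isIso_Q_compShift (hu : IsIso (Q.map u)) (n : ℤ) : IsIso (Q.map (compShift u n)) := by
  have := isIso_Q_map_shift hu n
  rw [compShift, Functor.map_comp]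
  infer_instance

section

lemma QBicone_coev_π (n : ℤ) (j : B.ι n) :
    Q.map B.coev ≫ (QBicone fun p : (Σ n, B.ι n) => I'⟦p.1⟧).π ⟨n, j⟩ = Q.map (B.e n j) := by
  rw [← coev_π]
  exact (Q.map_comp _ _).symm

variable (hΦ : IsSphericalFamily k P N fun n => Q.obj (I'⟦n⟧)) (hN : 1 ≤ N) (hG : P (Q.obj G))
  (hu : IsIso (Q.map u))

variable (k) in
/-- The linear equivalence between `Hom(I'⟦n + 1⟧, X)` and `Hom(I⟦n⟧, X⟦-1⟧)` that is induced by
a quasi-isomorphism `I ⟶ I'`. -/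
def compShiftEquiv (n : ℤ) (X : CochainComplex A ℤ) :
    (Q.obj (I'⟦n + 1⟧) ⟶ Q.obj X) ≃ₗ[k] (Q.obj (I⟦n⟧) ⟶ Q.obj (X⟦(-1 : ℤ)⟧)) :=
  have := isIso_Q_compShift hu n
  QShift k _ _ (-1) ≪≫ₗ
    Linear.homCongr k (asIso (Q.map (compShift u n))).symm (Iso.refl _)

variable (u) in
/-- The component `I⟦n⟧ ⟶ I'⟦n⟧ ≅ (I'⟦n + 1⟧)⟦-1⟧ ⟶ (I' ⊗ RHom(G, I')^*)⟦-1⟧ ⟶ B.cocone`. -/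
def coconeComponent (n : ℤ) (j : B.ι (n + 1)) : I⟦n⟧ ⟶ B.cocone :=
  (compShift u n ≫ (biproduct.ι (fun p : (Σ n, B.ι n) => I'⟦p.1⟧) ⟨n + 1, j⟩)⟦(-1 : ℤ)⟧') ≫
    (mappingCone.inr B.coev)⟦(-1 : ℤ)⟧'

lemma Q_map_coconeComponent (n : ℤ) (j : B.ι (n + 1)) :
    Q.map (B.coconeComponent u n j) = compShiftEquiv k hu n _
      ((QBicone fun p : (Σ n, B.ι n) => I'⟦p.1⟧).ι ⟨n + 1, j⟩ ≫
        Q.map (mappingCone.inr B.coev)) := by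
  have h : (QBicone fun p : (Σ n, B.ι n) => I'⟦p.1⟧).ι ⟨n + 1, j⟩ ≫
      Q.map (mappingCone.inr B.coev) = Q.map (biproduct.ι (fun p : (Σ n, B.ι n) => I'⟦p.1⟧)
        ⟨n + 1, j⟩ ≫ mappingCone.inr B.coev) := (Q.map_comp _ _).symm
  rw [h, compShiftEquiv, LinearEquiv.trans_apply, QShift_Q_map, Linear.homCongr_apply]
  change (Q.map (_ ≫ _) : Q.obj (I⟦n⟧) ⟶ Q.obj ((mappingCone B.coev)⟦(-1 : ℤ)⟧)) = _
  simp

/-- For a spherical `I'` and a quasi-isomorphism `u : I ⟶ I'`, a basis of `RHom(G, I')` gives a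
basis of `RHom(I, Y)` for the shifted cone `Y` of the coevaluation: it consists of the components
of `(I' ⊗ RHom(G, I')^*)⟦-1⟧ ⟶ Y`. -/
def coconeBasis : EvalBasis k I B.cocone where
  ι n := B.ι (n + 1)
  fintype_ι _ := inferInstance
  finite_sigma := Finite.of_equiv _ (sigmaShiftEquiv B.ι 1).symm
  e n j := B.coconeComponent u n j
  linearIndependent n :=
    linearIndependent_of_linearEquiv
      (hΦ.linearIndependent_cocone hN (QBicone fun p : (Σ n, B.ι n) => I'⟦p.1⟧) hG
        (Q_cone_distinguished B.coev)
        (fun n => span_eq_top_of_linearEquiv (B.span_eq_top n) (.refl k _) (B.QBicone_coev_π n)) (n + 1))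
      (compShiftEquiv k hu n _) (B.Q_map_coconeComponent hu n)
  span_eq_top n :=
    have := Fintype.ofFinite (Σ n, B.ι n)
    span_eq_top_of_linearEquiv
      (hΦ.span_cocone (QBicone fun p : (Σ n, B.ι n) => I'⟦p.1⟧) hG
        (Q_cone_distinguished B.coev)
        (fun n => linearIndependent_of_linearEquiv (B.linearIndependent n) (.refl k _)
          (B.QBicone_coev_π n))
        (fun n => span_eq_top_of_linearEquiv (B.span_eq_top n) (.refl k _) (B.QBicone_coev_π n))
        (sum_Q_map_π_comp_Q_map_ι _) (n + 1))
      (compShiftEquiv k hu n _) (B.Q_map_coconeComponent hu n)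

/-- The isomorphism (in the derived category) from the source of the evaluation of `B.cocone` to
`(I' ⊗ RHom(G, I')^*)⟦-1⟧`. -/
def tensorShift : (B.coconeBasis hΦ hN hG hu).tensor ⟶ B.tensor⟦(-1 : ℤ)⟧ :=
  biproduct.desc fun p => compShift u p.1 ≫
    (biproduct.ι (fun p : (Σ n, B.ι n) => I'⟦p.1⟧) ⟨p.1 + 1, p.2⟩)⟦(-1 : ℤ)⟧'

lemma ι_tensorShift (n : ℤ) (j : (B.coconeBasis hΦ hN hG hu).ι n) :
    biproduct.ι (fun p : (Σ n, (B.coconeBasis hΦ hN hG hu).ι n) => I⟦p.1⟧) ⟨n, j⟩ ≫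
      B.tensorShift hΦ hN hG hu =
    compShift u n ≫ (biproduct.ι (fun p : (Σ n, B.ι n) => I'⟦p.1⟧) ⟨n + 1, j⟩)⟦(-1 : ℤ)⟧' :=
  biproduct.ι_desc _ _

/-- Up to the isomorphism `tensorShift`, the evaluation of the shifted cone is the second morphism
of the triangle of the coevaluation, shifted by `-1`. -/
lemma coconeBasis_ev : (B.coconeBasis hΦ hN hG hu).ev =
    B.tensorShift hΦ hN hG hu ≫ (mappingCone.inr B.coev)⟦(-1 : ℤ)⟧' := by
  refine biproduct.hom_ext' _ _ ?_
  rintro ⟨n, j⟩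
  exact (EvalBasis.ι_ev _ n j).trans ((congrArg (fun x => x ≫ (mappingCone.inr B.coev)⟦(-1 : ℤ)⟧')
    (B.ι_tensorShift hΦ hN hG hu n j)).symm.trans (Category.assoc _ _ _))

lemma isIso_Q_tensorShift : IsIso (Q.map (B.tensorShift hΦ hN hG hu)) := by
  have := Fintype.ofFinite (Σ n, B.ι n)
  have := Fintype.ofFinite (Σ n, (B.coconeBasis hΦ hN hG hu).ι n)
  exact isIso_Q_of_ι_comp (fun p : (Σ n, B.ι n) => I'⟦p.1⟧)
    (fun p : (Σ n, (B.coconeBasis hΦ hN hG hu).ι n) => I⟦p.1⟧) (sigmaShiftEquiv B.ι 1) (-1)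
    (fun p => compShift u p.1) (fun p => isIso_Q_compShift hu p.1) _
    (fun p => B.ι_tensorShift hΦ hN hG hu p.1 p.2)

/-- The matrix, in the bases for the shifted cones, of the map that has the matrix `a` in the given
bases: its transpose, with the degrees lowered by one. -/
def coconeMatrix (hG' : P (Q.obj G')) (a : ∀ n, B'.ι n → B.ι n → k) (n : ℤ)
    (i : (B.coconeBasis hΦ hN hG hu).ι n) (j : (B'.coconeBasis hΦ hN hG' hu).ι n) : k :=
  a (n + 1) j i

lemma tensorMap_tensorShift (hG' : P (Q.obj G')) (a : ∀ n, B'.ι n → B.ι n → k) :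
    (B.coconeBasis hΦ hN hG hu).tensorMap (B'.coconeBasis hΦ hN hG' hu)
      (B.coconeMatrix B' hΦ hN hG hu hG' a) ≫ B'.tensorShift hΦ hN hG' hu =
    B.tensorShift hΦ hN hG hu ≫ (B.tensorMap B' a)⟦(-1 : ℤ)⟧' := by
  refine biproduct.hom_ext' _ _ ?_
  rintro ⟨n, j⟩
  rw [← Category.assoc, EvalBasis.ι_tensorMap, ← Category.assoc, ι_tensorShift, Category.assoc,
    ← Functor.map_comp]
  refine Eq.trans ?_ (congrArg (fun x => compShift u n ≫ x⟦(-1 : ℤ)⟧')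
    (B.ι_tensorMap B' a (n + 1) j)).symm
  rw [Preadditive.sum_comp, Functor.map_sum, Preadditive.comp_sum]
  refine Finset.sum_congr rfl fun i _ => ?_
  rw [Linear.smul_comp, Functor.map_smul, Linear.comp_smul]
  exact congrArg _ (B'.ι_tensorShift hΦ hN hG' hu n i)

end

end CoevBasis

end

end SphericalTwist

/-! ### The two compositions -/

namespace SphericalTwist

noncomputable section

open Pretriangulated CochainComplex DerivedCategory

variable {k : Type t} [Field k] {A : Type u} [Category.{v} A] [Abelian A] [Linear k A]
  [HasDerivedCategory.{w} A] {P : ObjectProperty (DerivedCategory A)} [P.IsTriangulated]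
  [P.IsClosedUnderIsomorphisms] {I I' : CochainComplex A ℤ}
  {N : ℤ} {T T' : P.FullSubcategory ⥤ P.FullSubcategory} (D : TwistData k P I T)
  (D' : DualTwistData k P I' T') {u : I ⟶ I'} (hu : IsIso (Q.map u)) (hN : 1 ≤ N)

section DualTwistAfterTwist

variable (hΦ : IsSphericalFamily k P N fun n => Q.obj (I⟦n⟧)) (hI : P (Q.obj I))

/-- The cone of the evaluation of a model, as an object of `P`. -/
def EvalModel.coneObj (x : EvalModel k P I) : P.FullSubcategory :=
  ⟨Q.obj x.basis.cone, prop_cone hI x.prop x.basis⟩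

/-- A twist functor takes a model to the cone of the evaluation. -/
def TwistData.objIso (x : EvalModel k P I) : T.obj x.obj ≅ x.coneObj hI :=
  P.isoMk (D.iso x.G x.prop x.basis)

lemma TwistData.objIso_naturality {x y : EvalModel k P I} (f : x.G ⟶ y.G)
    (a : ∀ n, x.basis.ι n → y.basis.ι n → k)
    (H : Homotopy (x.basis.ev ≫ f) (x.basis.tensorMap y.basis a ≫ y.basis.ev)) :
    T.map (P.homMk (Q.map f) : x.obj ⟶ y.obj) ≫ (D.objIso hI y).hom =
      (D.objIso hI x).hom ≫ (P.homMk (Q.map (mappingCone.mapOfHomotopy H)) :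
        x.coneObj hI ⟶ y.coneObj hI) := by
  ext
  exact D.naturality x.G y.G x.prop y.prop x.basis y.basis f a H

variable [I.IsKInjective]

/-- A dual twist functor takes the cone of the evaluation of a model back to this model, by
the rotation of the triangle of the evaluation. -/
def DualTwistData.coneIso (x : EvalModel k P I) : T'.obj (x.coneObj hI) ≅ x.obj :=
  P.isoMk (D'.iso x.basis.cone (x.coneObj hI).property (x.basis.coneBasis hΦ hN x.prop hu) ≪≫
    rotationIso x.basis.ev (x.basis.coneBasis_coev hΦ hN x.prop hu)
      (x.basis.isIso_Q_shiftTensor hΦ hN x.prop hu))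

lemma DualTwistData.coneIso_naturality {x y : EvalModel k P I} (f : x.G ⟶ y.G)
    (a : ∀ n, x.basis.ι n → y.basis.ι n → k)
    (H : Homotopy (x.basis.ev ≫ f) (x.basis.tensorMap y.basis a ≫ y.basis.ev)) :
    T'.map (P.homMk (Q.map (mappingCone.mapOfHomotopy H)) :
        x.coneObj hI ⟶ y.coneObj hI) ≫ (D'.coneIso hu hN hΦ hI y).hom =
      (D'.coneIso hu hN hΦ hI x).hom ≫ (P.homMk (Q.map f) : x.obj ⟶ y.obj) := by
  have hm := IsConeMap.mapOfHomotopy H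
  have comm : (x.basis.coneBasis hΦ hN x.prop hu).coev ≫
      (x.basis.coneBasis hΦ hN x.prop hu).tensorMap (y.basis.coneBasis hΦ hN y.prop hu)
        (x.basis.coneMatrix y.basis hΦ hN x.prop hu y.prop a) =
      mappingCone.mapOfHomotopy H ≫ (y.basis.coneBasis hΦ hN y.prop hu).coev :=
    hm.comp_eq (x.basis.coneBasis_coev hΦ hN x.prop hu) (y.basis.coneBasis_coev hΦ hN y.prop hu)
      (x.basis.shiftTensor_tensorMap y.basis hΦ hN x.prop hu y.prop a)
  have h1 := D'.naturality x.basis.cone y.basis.cone (x.coneObj hI).property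
    (y.coneObj hI).property (x.basis.coneBasis hΦ hN x.prop hu)
    (y.basis.coneBasis hΦ hN y.prop hu) (mappingCone.mapOfHomotopy H)
    (x.basis.coneMatrix y.basis hΦ hN x.prop hu y.prop a) (Homotopy.ofEq comm)
  have h2 := rotationIso_naturality (x.basis.coneBasis_coev hΦ hN x.prop hu)
    (y.basis.coneBasis_coev hΦ hN y.prop hu) (x.basis.isIso_Q_shiftTensor hΦ hN x.prop hu)
    (y.basis.isIso_Q_shiftTensor hΦ hN y.prop hu) hm comm
  ext
  exact (Category.assoc _ _ _).symm.trans ((congrArg (fun z => z ≫ _) h1).trans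
    ((Category.assoc _ _ _).trans ((congrArg (fun z => _ ≫ z) h2).trans
      (Category.assoc _ _ _).symm)))

include D D' hu hN hΦ hI in
lemma nonempty_twist_comp_dualTwist_iso
    (hp : ∀ X, ∃ x : EvalModel k P I, Nonempty (x.obj ≅ X)) : Nonempty (T ⋙ T' ≅ 𝟭 _) := by
  refine nonempty_natIso_of_models EvalModel.obj hp (T ⋙ T') (𝟭 _)
    (fun x => T'.mapIso (D.objIso hI x) ≪≫ D'.coneIso hu hN hΦ hI x) fun x y φ => ?_
  obtain ⟨f, a, hf, ⟨H⟩⟩ := EvalBasis.exists_homotopy (B := x.basis) (B' := y.basis) φ.hom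
  obtain rfl : φ = P.homMk (Q.map f) := by
    ext
    exact hf.symm
  have h1 := congrArg T'.map (D.objIso_naturality hI f a H)
  rw [Functor.map_comp, Functor.map_comp] at h1
  have h2 := D'.coneIso_naturality hu hN hΦ hI f a H
  simp only [Functor.comp_map, Functor.id_map, Iso.trans_hom, Functor.mapIso_hom, Category.assoc]
  rw [reassoc_of% h1, h2]

end DualTwistAfterTwist

section TwistAfterDualTwist

variable (hΦ : IsSphericalFamily k P N fun n => Q.obj (I'⟦n⟧)) (hI : P (Q.obj I'))

/-- The shifted cone of the coevaluation of a model, as an object of `P`. -/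
def CoevModel.coconeObj (x : CoevModel k P I') : P.FullSubcategory :=
  ⟨Q.obj x.basis.cocone, prop_cocone hI x.prop x.basis⟩

/-- A dual twist functor takes a model to the shifted cone of the coevaluation. -/
def DualTwistData.objIso (x : CoevModel k P I') : T'.obj x.obj ≅ x.coconeObj hI :=
  P.isoMk (D'.iso x.G x.prop x.basis)

lemma DualTwistData.objIso_naturality {x y : CoevModel k P I'} (f : x.G ⟶ y.G)
    (a : ∀ n, y.basis.ι n → x.basis.ι n → k)
    (H : Homotopy (x.basis.coev ≫ x.basis.tensorMap y.basis a) (f ≫ y.basis.coev)) :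
    T'.map (P.homMk (Q.map f) : x.obj ⟶ y.obj) ≫ (D'.objIso hI y).hom =
      (D'.objIso hI x).hom ≫ (P.homMk (Q.map ((mappingCone.mapOfHomotopy H)⟦(-1 : ℤ)⟧')) :
        x.coconeObj hI ⟶ y.coconeObj hI) := by
  ext
  exact D'.naturality x.G y.G x.prop y.prop x.basis y.basis f a H

variable [I'.IsKInjective]

/-- A twist functor takes the shifted cone of the coevaluation of a model back to this model, by
the inverse rotation of the triangle of the coevaluation. -/
def TwistData.coconeIso (x : CoevModel k P I') : T.obj (x.coconeObj hI) ≅ x.obj :=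
  P.isoMk (D.iso x.basis.cocone (x.coconeObj hI).property
      (x.basis.coconeBasis hΦ hN x.prop hu) ≪≫
    invRotationIso x.basis.coev (x.basis.coconeBasis_ev hΦ hN x.prop hu)
      (x.basis.isIso_Q_tensorShift hΦ hN x.prop hu))

lemma TwistData.coconeIso_naturality {x y : CoevModel k P I'} (f : x.G ⟶ y.G)
    (a : ∀ n, y.basis.ι n → x.basis.ι n → k)
    (H : Homotopy (x.basis.coev ≫ x.basis.tensorMap y.basis a) (f ≫ y.basis.coev)) :
    T.map (P.homMk (Q.map ((mappingCone.mapOfHomotopy H)⟦(-1 : ℤ)⟧')) :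
        x.coconeObj hI ⟶ y.coconeObj hI) ≫ (D.coconeIso hu hN hΦ hI y).hom =
      (D.coconeIso hu hN hΦ hI x).hom ≫ (P.homMk (Q.map f) : x.obj ⟶ y.obj) := by
  have hm := IsConeMap.mapOfHomotopy H
  have comm : (x.basis.coconeBasis hΦ hN x.prop hu).ev ≫
      (mappingCone.mapOfHomotopy H)⟦(-1 : ℤ)⟧' =
      (x.basis.coconeBasis hΦ hN x.prop hu).tensorMap (y.basis.coconeBasis hΦ hN y.prop hu)
        (x.basis.coconeMatrix y.basis hΦ hN x.prop hu y.prop a) ≫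
        (y.basis.coconeBasis hΦ hN y.prop hu).ev :=
    hm.shift_comp_eq (x.basis.coconeBasis_ev hΦ hN x.prop hu)
      (y.basis.coconeBasis_ev hΦ hN y.prop hu)
      (x.basis.tensorMap_tensorShift y.basis hΦ hN x.prop hu y.prop a)
  have h1 := D.naturality x.basis.cocone y.basis.cocone (x.coconeObj hI).property
    (y.coconeObj hI).property (x.basis.coconeBasis hΦ hN x.prop hu)
    (y.basis.coconeBasis hΦ hN y.prop hu) ((mappingCone.mapOfHomotopy H)⟦(-1 : ℤ)⟧')
    (x.basis.coconeMatrix y.basis hΦ hN x.prop hu y.prop a) (Homotopy.ofEq comm)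
  have h2 := invRotationIso_naturality (x.basis.coconeBasis_ev hΦ hN x.prop hu)
    (y.basis.coconeBasis_ev hΦ hN y.prop hu) (x.basis.isIso_Q_tensorShift hΦ hN x.prop hu)
    (y.basis.isIso_Q_tensorShift hΦ hN y.prop hu) hm comm
  ext
  exact (Category.assoc _ _ _).symm.trans ((congrArg (fun z => z ≫ _) h1).trans
    ((Category.assoc _ _ _).trans ((congrArg (fun z => _ ≫ z) h2).trans
      (Category.assoc _ _ _).symm)))

include D D' hu hN hΦ hI in
lemma nonempty_dualTwist_comp_twist_iso
    (hp : ∀ X, ∃ x : CoevModel k P I', Nonempty (x.obj ≅ X)) : Nonempty (T' ⋙ T ≅ 𝟭 _) := by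
  refine nonempty_natIso_of_models CoevModel.obj hp (T' ⋙ T) (𝟭 _)
    (fun x => T.mapIso (D'.objIso hI x) ≪≫ D.coconeIso hu hN hΦ hI x) fun x y φ => ?_
  obtain ⟨f, a, hf, ⟨H⟩⟩ := CoevBasis.exists_homotopy (B := x.basis) (B' := y.basis) φ.hom
  obtain rfl : φ = P.homMk (Q.map f) := by
    ext
    exact hf.symm
  have h1 := congrArg T.map (D'.objIso_naturality hI f a H)
  rw [Functor.map_comp, Functor.map_comp] at h1
  have h2 := D.coconeIso_naturality hu hN hΦ hI f a H
  simp only [Functor.comp_map, Functor.id_map, Iso.trans_hom, Functor.mapIso_hom, Category.assoc]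
  rw [reassoc_of% h1, h2]

end TwistAfterDualTwist

end

end SphericalTwist

theorem mainTheorem3 {k : Type t} [Field k]
    {A : Type u} [Category.{v} A] [Abelian A] [Linear k A] [EnoughInjectives A]
    [HasDerivedCategory.{w} A]
    (P : ObjectProperty (DerivedCategory A)) [P.IsTriangulated] [P.IsClosedUnderIsomorphisms]
    (hP : P ≤ DerivedCategory.TStructure.t.bounded)
    (N : ℕ) (hN : 1 ≤ N) (F : DerivedCategory A) (hF : P F)
    (hsph : SphericalTwist.IsSpherical k (N : ℤ) F)
    (hdual : SphericalTwist.HasDuality k P (N : ℤ) F) :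
    (∃ T : P.FullSubcategory ⥤ P.FullSubcategory, SphericalTwist.IsTwist k P F T) ∧
    (∃ T' : P.FullSubcategory ⥤ P.FullSubcategory, SphericalTwist.IsDualTwist k P F T') ∧
    ∀ T T' : P.FullSubcategory ⥤ P.FullSubcategory,
      SphericalTwist.IsTwist k P F T → SphericalTwist.IsDualTwist k P F T' →
      Nonempty (T' ⋙ T ≅ 𝟭 P.FullSubcategory) ∧ Nonempty (T ⋙ T' ≅ 𝟭 P.FullSubcategory) := by
  have hN' : (1 : ℤ) ≤ N := by exact_mod_cast hN
  obtain ⟨I₀, hI₀, ⟨e₀⟩⟩ := SphericalTwist.exists_isKInjective_iso (hP _ hF)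
  have hPI₀ := P.prop_of_iso e₀.symm hF
  refine ⟨?_, ?_, ?_⟩
  · obtain ⟨T, hT⟩ := SphericalTwist.exists_twistData hPI₀
      (SphericalTwist.exists_evalModel e₀ hP hF hsph hdual)
    exact ⟨T, I₀, hI₀, ⟨e₀⟩, hT⟩
  · obtain ⟨T', hT'⟩ := SphericalTwist.exists_dualTwistData hPI₀
      (SphericalTwist.exists_coevModel e₀ hP hF hsph hdual)
    exact ⟨T', I₀, hI₀, ⟨e₀⟩, hT'⟩
  · rintro T T' ⟨I, hI, ⟨e⟩, ⟨D⟩⟩ ⟨I', hI', ⟨e'⟩, ⟨D'⟩⟩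
    -- the two resolutions of `F` may differ; they are compared by a quasi-isomorphism `u`
    obtain ⟨u, hu⟩ := SphericalTwist.exists_Q_map_eq (e.hom ≫ e'.inv)
    have hu' : IsIso (DerivedCategory.Q.map u) := by
      rw [hu]
      infer_instance
    exact ⟨SphericalTwist.nonempty_dualTwist_comp_twist_iso D D' hu' hN'
        (SphericalTwist.isSphericalFamily (SphericalTwist.QShiftIso e') hsph hdual)
        (P.prop_of_iso e'.symm hF) (SphericalTwist.exists_coevModel e' hP hF hsph hdual),
      SphericalTwist.nonempty_twist_comp_dualTwist_iso D D' hu' hN'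
        (SphericalTwist.isSphericalFamily (SphericalTwist.QShiftIso e) hsph hdual)
        (P.prop_of_iso e.symm hF) (SphericalTwist.exists_evalModel e hP hF hsph hdual)⟩
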